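/- Let $N\ge 0$, $m\ge 1$ be integers, $\mathbb T^N=\mathbb R^N/\mathbb Z^N$, and let functions on $\mathbb T^N$ be identified with $\mathbb Z^N$-periodic functions on $\mathbb R^N$. Let $D(x)=(d_{ij}(x))_{1\le i,j\le m}$ have continuous entries $d_{ij}:\mathbb T^N\to\mathbb R$ with, for all $x$ and $i$, $d_{ii}(x)\ge 0$, $d_{ij}(x)\le 0$ for $j\ne i$, and $\sum_{j=1}^m d_{ij}(x)\ge 0$. Assume that $D(x)$ is irreducible for every $x$: for every nonempty $\mathcal I\subsetneq\{1,\dots,m\}$ there are $i\in\mathcal I$ and $j\notin\mathcal I$ with $d_{ij}(x)\neq 0$. For $1\le i\le m$ let $H_i(x,p)=F_i(x,p)-f_i(x)$, where $F_i:\mathbb T^N\times\mathbb R^N\to\mathbb R$ and $f_i:\mathbb T^N\to\mathbb R$ are continuous, $F_i(x,\cdot)$ is convex and coercive ($F_i(x,p)\to+\infty$ as $|p|\to\infty$), $F_i(x,p)\ge F_i(x,0)=0$ and $f_i(x)\ge 0$ for all $x,p$. Consider the system $$H_i(x,Du_i)+\sum_{j=1}^m d_{ij}(x)u_j=0\quad\text{in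 }\mathbb T^N,\qquad 1\le i\le m.\tag{1}$$ An upper (resp. lower) semicontinuous $u:\mathbb T^N\to\mathbb R^m$ is a viscosity subsolution (resp. supersolution) of (1) if, whenever $\varphi\in C^1$, $i\in\{1,\dots,m\}$ and $u_i-\varphi$ has a local maximum (resp. minimum) at $x$, one has $H_i(x,D\varphi(x))+\sum_j d_{ij}(x)u_j(x)\le 0$ (resp. $\ge 0$); a continuous $u$ which is both is a viscosity solution. (i) If $\sum_{j=1}^m d_{ij}(x)>0$ for all $x\in\mathbb T^N$ and all $i$, then (1) has a unique continuous viscosity solution $u:\mathbb T^N\to\mathbb R^m$. (ii) Suppose that $\sum_{j=1}^m d_{ij}(x)=0$ for all $x\in\mathbb T^N$ and all $i$, and that $\mathbb F=\{x\in\mathbb T^N:\sum_{i=1}^m f_i(x)=0\}$ is nonempty. Put $F=\max_i F_i$ and $f=\min_i f_i$. Then, for all $x,y\in\mathbb T^N$, the maximum $$S(y,x)=\max\{v(x): v:\mathbb T^N\to\mathbb R \text{ upper semicontinuous viscosity subsolution of }F(x,Dv)\le f(x)\text{ on }\mathbb T^N,\ v(y)=0\}$$ exists, and there is a continuous $\Lambda=(\Lambda_1,\dots,\Lambda_m):\mathbb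 T^N\to\mathbb R^m$ with $\Lambda_i(x)>0$ for all $i$ and $D(x)^T\Lambda(x)=0$ for all $x$. Moreover, for every such $\Lambda$ and every continuous $g:\mathbb F\to\mathbb R$ satisfying $$\frac{g(x)}{\sum_{i=1}^m\Lambda_i(x)}-\frac{g(y)}{\sum_{i=1}^m\Lambda_i(y)}\le S(y,x)\qquad\text{for all }x,y\in\mathbb F,$$ there exists a unique continuous viscosity solution $u$ of (1) such that $\sum_{i=1}^m\Lambda_i(x)u_i(x)=g(x)$ for all $x\in\mathbb F$. -/

import Mathlib

open Filter Set

noncomputable section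

namespace WeaklyCoupledHJ

/-- `ℝ^N` with its Euclidean norm. -/
abbrev Space (N : ℕ) : Type := EuclideanSpace ℝ (Fin N)

/-- The vector of `ℝ^N` with integer coordinates `k`. -/
def latticeVec {N : ℕ} (k : Fin N → ℤ) : Space N := WithLp.toLp 2 (fun a => (k a : ℝ))

/-- `u` is `1`-periodic in every coordinate, i.e. a function on the torus `𝕋^N = ℝ^N / ℤ^N`.
Functions on the torus are represented by their periodic lifts to `ℝ^N`. -/
def IsPeriodic {N : ℕ} {α : Type*} (u : Space N → α) : Prop :=
  ∀ (x : Space N) (k : Fin N → ℤ), u (x + latticeVec k) = u x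

/-- Standing assumptions on the coupling matrix: continuous entries on the torus, nonnegative
diagonal, nonpositive off-diagonal entries, nonnegative row sums. -/
structure IsCouplingMatrix {N m : ℕ} (D : Space N → Matrix (Fin m) (Fin m) ℝ) : Prop where
  continuous : ∀ i j, Continuous fun x => D x i j
  periodic : IsPeriodic D
  diag_nonneg : ∀ x i, 0 ≤ D x i i
  offDiag_nonpos : ∀ x i j, i ≠ j → D x i j ≤ 0
  rowSum_nonneg : ∀ x i, 0 ≤ ∑ j, D x i j

/-- A square matrix is irreducible if every nonempty proper set `I` of indices contains some `i`
that is coupled (`A i j ≠ 0`) to some `j` outside of `I`. -/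
def IsIrreducibleMatrix {m : ℕ} (A : Matrix (Fin m) (Fin m) ℝ) : Prop :=
  ∀ I : Set (Fin m), I.Nonempty → I ≠ univ → ∃ i ∈ I, ∃ j ∉ I, A i j ≠ 0

/-- Standing assumptions on the Hamiltonians `H_i(x,p) = F_i(x,p) - f_i(x)`. -/
structure IsEikonalFamily {N m : ℕ} (F : Fin m → Space N → Space N → ℝ)
    (f : Fin m → Space N → ℝ) : Prop where
  continuous_F : ∀ i, Continuous fun z : Space N × Space N => F i z.1 z.2
  continuous_f : ∀ i, Continuous (f i)
  periodic_F : ∀ i p, IsPeriodic fun x => F i x p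
  periodic_f : ∀ i, IsPeriodic (f i)
  convex : ∀ i x, ConvexOn ℝ univ (F i x)
  coercive : ∀ i x, Tendsto (F i x) (cocompact (Space N)) atTop
  F_zero : ∀ i x, F i x 0 = 0
  F_nonneg : ∀ i x p, 0 ≤ F i x p
  f_nonneg : ∀ i x, 0 ≤ f i x

/-- Viscosity subsolutions on the torus of the system
`H_i(x, Du_i) + ∑_j d_ij(x) u_j = 0`, `1 ≤ i ≤ m`. -/
def IsSubsolution {N m : ℕ} (H : Fin m → Space N → Space N → ℝ)
    (D : Space N → Matrix (Fin m) (Fin m) ℝ) (u : Space N → Fin m → ℝ) : Prop :=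
  IsPeriodic u ∧ (∀ i, UpperSemicontinuous fun x => u x i) ∧
    ∀ (φ : Space N → ℝ) (i : Fin m) (x : Space N), ContDiff ℝ 1 φ →
      IsLocalMax (fun y => u y i - φ y) x →
        H i x (gradient φ x) + ∑ j, D x i j * u x j ≤ 0

/-- Viscosity supersolutions on the torus of the system. -/
def IsSupersolution {N m : ℕ} (H : Fin m → Space N → Space N → ℝ)
    (D : Space N → Matrix (Fin m) (Fin m) ℝ) (u : Space N → Fin m → ℝ) : Prop :=
  IsPeriodic u ∧ (∀ i, LowerSemicontinuous fun x => u x i) ∧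
    ∀ (φ : Space N → ℝ) (i : Fin m) (x : Space N), ContDiff ℝ 1 φ →
      IsLocalMin (fun y => u y i - φ y) x →
        0 ≤ H i x (gradient φ x) + ∑ j, D x i j * u x j

/-- Continuous viscosity solutions on the torus of the system. -/
def IsSolution {N m : ℕ} (H : Fin m → Space N → Space N → ℝ)
    (D : Space N → Matrix (Fin m) (Fin m) ℝ) (u : Space N → Fin m → ℝ) : Prop :=
  Continuous u ∧ IsSubsolution H D u ∧ IsSupersolution H D u

/-- The (lifted) set `𝔽` of points of the torus at which `∑_i f_i` vanishes. -/
def zeroSet {N m : ℕ} (f : Fin m → Space N → ℝ) : Set (Space N) :=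
  {x | ∑ i, f i x = 0}

/-- `F(x,p) = max_i F_i(x,p)` (for `m ≥ 1`). -/
def maxF {N m : ℕ} (F : Fin m → Space N → Space N → ℝ) (x p : Space N) : ℝ := ⨆ i, F i x p

/-- `f(x) = min_i f_i(x)` (for `m ≥ 1`). -/
def minf {N m : ℕ} (f : Fin m → Space N → ℝ) (x : Space N) : ℝ := ⨅ i, f i x

/-- Viscosity subsolutions on the torus of the scalar equation `G(x, Dv) ≤ h(x)`. -/
def IsScalarSubsolution {N : ℕ} (G : Space N → Space N → ℝ) (h : Space N → ℝ)
    (v : Space N → ℝ) : Prop :=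
  IsPeriodic v ∧ UpperSemicontinuous v ∧
    ∀ (φ : Space N → ℝ) (x : Space N), ContDiff ℝ 1 φ →
      IsLocalMax (fun y => v y - φ y) x → G x (gradient φ x) ≤ h x

/-- The values at `x` of the subsolutions of `G(x, Dv) ≤ h(x)` that vanish at `y`. -/
def subsolutionValues {N : ℕ} (G : Space N → Space N → ℝ) (h : Space N → ℝ)
    (y x : Space N) : Set ℝ :=
  {r | ∃ v, IsScalarSubsolution G h v ∧ v y = 0 ∧ v x = r}

/-- The maximal subsolution `S(y,x) = max {v(x) : F(x, Dv) ≤ f(x), v(y) = 0}` of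
Fathi and Siconolfi, for `F = max_i F_i` and `f = min_i f_i`. -/
def maximalSubsolution {N m : ℕ} (F : Fin m → Space N → Space N → ℝ)
    (f : Fin m → Space N → ℝ) (y x : Space N) : ℝ :=
  sSup (subsolutionValues (maxF F) (minf f) y x)

/-- `L` is a positive continuous vector field on the torus with `D(x)ᵀ L(x) = 0` for all `x`. -/
def IsPositiveCokernel {N m : ℕ} (D : Space N → Matrix (Fin m) (Fin m) ℝ)
    (L : Space N → Fin m → ℝ) : Prop :=
  Continuous L ∧ IsPeriodic L ∧ (∀ x i, 0 < L x i) ∧ ∀ x, (D x).transpose.mulVec (L x) = 0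

end WeaklyCoupledHJ

end

/-! Each equation is read as `F_i(x, Du_i) = f_i - (D u)_i`, the right side (`residual`) being
treated as a given continuous function. As `F_i ≥ 0`, a continuous subsolution satisfies `D u ≤ f`
pointwise (`ViscSub.nonneg`); as `F_i` is coercive, bounds on the residual give Lipschitz bounds
(`ViscSub.lipBound`).

Uniqueness: doubling of variables at a maximum of `c u_i - v_i`, `0 < c ≤ 1`, gives `(D (c u - v))_i
≤ (c - 1) f_i` there (`residual_le_at_max`), because convexity and `F_i(x, 0) = 0` make `c u` a
subsolution with right side `c` times the residual. With positive row sums `c = 1` suffices. With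
zero row sums and `c < 1`, irreducibility makes all components reach the maximum at the same point,
which forces every `f_i` to vanish there. So solutions are compared by their values on the zero set.
On that set `D u ≤ 0` makes all components of `u` equal, hence the datum `∑ Λ_i u_i = g` fixes `u`
to be `g / ∑ Λ_i`.

Existence: Perron's method with values prescribed on a closed set (`perronSup_mem`,
`perronSup_super`). In case (i) this set is empty and the barriers are constants. In case (ii) it is
the zero set, where the supersolution test is trivial. The lower barrier is the vector with all
components equal to a scalar subsolution `w` of `max F_i ≤ min f_i`, and equi-Lipschitz bounds keep
the envelope below the upper barrier. Compatibility of the data with `S` is what produces `w`, as a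
supremum of the functions `h(y) - S(·, y)` (`exists_isScalarSubsolution_extension`). That these are
subsolutions needs convexity (`ViscSub.const_sub`).

The field `Λ` is the absolute value of the diagonal of the adjugate of `D`, continuous because it is
built from polynomials in the entries. -/

open Topology

noncomputable section

namespace WeaklyCoupledHJ

/-! ### Gradients of the test functions. -/

section Gradient

variable {N : ℕ}

theorem hasGradientAt_add {φ ψ : Space N → ℝ} {p q x : Space N} (hφ : HasGradientAt φ p x)
    (hψ : HasGradientAt ψ q x) : HasGradientAt (fun y => φ y + ψ y) (p + q) x := by
  rw [hasGradientAt_iff_hasFDerivAt] at *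
  rw [map_add]
  exact hφ.add hψ

theorem hasGradientAt_neg {φ : Space N → ℝ} {p x : Space N} (hφ : HasGradientAt φ p x) :
    HasGradientAt (fun y => - φ y) (-p) x := by
  rw [hasGradientAt_iff_hasFDerivAt] at *
  rw [map_neg]
  exact hφ.neg

theorem hasGradientAt_inner (e a x : Space N) :
    HasGradientAt (fun y => inner ℝ e (y - a)) e x := by
  rw [hasGradientAt_iff_hasFDerivAt]
  have h : HasFDerivAt (fun y : Space N => y - a) (ContinuousLinearMap.id ℝ (Space N)) x :=
    (hasFDerivAt_id x).sub_const a
  exact (InnerProductSpace.toDual ℝ (Space N) e).hasFDerivAt.comp x h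

theorem hasGradientAt_norm_sq (c : ℝ) (a x : Space N) :
    HasGradientAt (fun y => c * ‖y - a‖ ^ 2) ((2 * c) • (x - a)) x := by
  rw [hasGradientAt_iff_hasFDerivAt]
  have h : HasFDerivAt (fun y : Space N => y - a) (ContinuousLinearMap.id ℝ (Space N)) x :=
    (hasFDerivAt_id x).sub_const a
  have h2 := (h.norm_sq).const_mul c
  refine h2.congr_fderiv ?_
  ext y
  simp
  ring

theorem contDiff_norm_sub_sq (c : ℝ) (a : Space N) :
    ContDiff ℝ 1 (fun y : Space N => c * ‖y - a‖ ^ 2) :=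
  contDiff_const.mul ((contDiff_id.sub contDiff_const).norm_sq ℝ)

theorem contDiff_hasGradientAt {φ : Space N → ℝ} (hφ : ContDiff ℝ 1 φ) (x : Space N) :
    HasGradientAt φ (gradient φ x) x :=
  (hφ.differentiable one_ne_zero x).hasGradientAt

theorem contDiff_continuous_gradient {φ : Space N → ℝ} (hφ : ContDiff ℝ 1 φ) :
    Continuous (gradient φ) :=
  (InnerProductSpace.toDual ℝ (Space N)).symm.continuous.comp (hφ.continuous_fderiv one_ne_zero)

theorem norm_gradient_const_mul_norm {c : ℝ} (hc : 0 ≤ c) {a x : Space N} (hx : x ≠ a) :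
    ‖gradient (fun y : Space N => c * ‖y - a‖) x‖ = c := by
  have hpos : 0 < ‖x - a‖ := norm_pos_iff.2 (sub_ne_zero.2 hx)
  have h := hasGradientAt_norm_sq 1 a x
  rw [hasGradientAt_iff_hasFDerivAt] at h
  have h2 := (h.sqrt (by simpa using hpos.ne')).const_mul c
  have h3 : HasGradientAt (fun y : Space N => c * ‖y - a‖) ((c / ‖x - a‖) • (x - a)) x := by
    rw [hasGradientAt_iff_hasFDerivAt]
    have heq : (fun y : Space N => c * √(1 * ‖y - a‖ ^ 2)) = fun y => c * ‖y - a‖ := by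
      ext y; simp
    rw [heq] at h2
    refine h2.congr_fderiv ?_
    ext y
    simp
    field_simp
  rw [h3.gradient, norm_smul, Real.norm_of_nonneg (by positivity)]
  field_simp

end Gradient

/-! ### Scalar viscosity inequalities and Lipschitz regularity. -/

section ViscSub

variable {N : ℕ} {G : Space N → Space N → ℝ} {A B v w : Space N → ℝ} {K : ℝ}

/-- Viscosity test for `G(x, Dv) ≤ A(x)`. -/
def ViscSub (G : Space N → Space N → ℝ) (A v : Space N → ℝ) : Prop :=
  ∀ (φ : Space N → ℝ) (x : Space N), ContDiff ℝ 1 φ →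
    IsLocalMax (fun y => v y - φ y) x → G x (gradient φ x) ≤ A x

/-- Viscosity test for `B(x) ≤ G(x, Dv)`. -/
def ViscSuper (G : Space N → Space N → ℝ) (B v : Space N → ℝ) : Prop :=
  ∀ (φ : Space N → ℝ) (x : Space N), ContDiff ℝ 1 φ →
    IsLocalMin (fun y => v y - φ y) x → B x ≤ G x (gradient φ x)

/-- `v` is Lipschitz with constant `K`. -/
def LipBound (K : ℝ) (v : Space N → ℝ) : Prop := ∀ x y, v x - v y ≤ K * ‖x - y‖

theorem LipBound.continuous (h : LipBound K v) : Continuous v := by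
  have : LipschitzWith K.toNNReal v := by
    refine LipschitzWith.of_le_add_mul _ fun x y => ?_
    have h1 := h x y
    have h2 : K * ‖x - y‖ ≤ K.toNNReal * ‖x - y‖ :=
      mul_le_mul_of_nonneg_right (Real.le_coe_toNNReal K) (norm_nonneg _)
    rw [dist_eq_norm]
    linarith
  exact this.continuous

theorem LipBound.neg_add_const (h : LipBound K v) (c : ℝ) : LipBound K (fun x => c - v x) := by
  intro x y
  have := h y x
  rw [norm_sub_rev] at this
  show c - v x - (c - v y) ≤ _
  linarith

/-- A supremum of functions with a common Lipschitz constant. -/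
theorem LipBound.iSup {ι : Type*} {v : ι → Space N → ℝ} (hv : ∀ i, LipBound K (v i))
    (hub : ∀ i x, v i x ≤ w x) (hlub : ∀ x, ∀ ε > 0, ∃ i, w x - ε < v i x) : LipBound K w := by
  intro x y
  refine le_of_forall_pos_le_add fun ε hε => ?_
  obtain ⟨i, hi⟩ := hlub x ε hε
  have := hv i x y
  have := hub i y
  linarith

/-- Multiplying by a bump function turns a locally `C^1` test function into a global one with the
same germ. This allows cones `c ‖y - a‖` as test functions away from their vertex. -/
theorem ViscSub.le_of_contDiffAt (h : ViscSub G A v) {φ : Space N → ℝ} {x : Space N}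
    (hφ : ContDiffAt ℝ 1 φ x) (hmax : IsLocalMax (fun y => v y - φ y) x) :
    G x (gradient φ x) ≤ A x := by
  have hev := hφ.eventually (by simp)
  obtain ⟨ε, hε, hball⟩ := Metric.eventually_nhds_iff.1 hev
  let b : ContDiffBump x := ⟨ε / 3, ε / 2, by positivity, by linarith⟩
  have hb : (fun y => b y * φ y) =ᶠ[𝓝 x] φ := by
    filter_upwards [b.eventuallyEq_one] with y hy
    simp [hy]
  have hsm : ContDiff ℝ 1 (fun y => b y * φ y) := by
    rw [contDiff_iff_contDiffAt]
    intro y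
    by_cases hy : dist y x < ε
    · exact b.contDiffAt.mul (hball hy)
    · have hy' : y ∉ tsupport b := by
        rw [b.tsupport_eq, Metric.mem_closedBall]
        show ¬ dist y x ≤ ε / 2
        linarith
      have h0 := notMem_tsupport_iff_eventuallyEq.1 hy'
      refine (contDiffAt_const (c := (0 : ℝ))).congr_of_eventuallyEq ?_
      filter_upwards [h0] with z hz
      simp [hz]
  have hmax' : IsLocalMax (fun y => v y - b y * φ y) x := by
    refine hmax.congr ?_
    filter_upwards [hb] with y hy
    simp only [hy]
  rw [← hb.gradient_eq]
  exact h _ x hsm hmax'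

theorem ViscSub.mono (h : ViscSub G A v) (hAB : ∀ x, A x ≤ B x) : ViscSub G B v :=
  fun φ x hφ hx => (h φ x hφ hx).trans (hAB x)

theorem ViscSub.sub_const (h : ViscSub G A v) (c : ℝ) : ViscSub G A (fun x => v x - c) := by
  intro φ x hφ hx
  refine h φ x hφ ?_
  filter_upwards [hx] with y hy
  linarith

theorem gradient_comp_add_right (φ : Space N → ℝ) (a x : Space N) :
    gradient (fun y => φ (y + a)) x = gradient φ (x + a) := by
  simp only [gradient, fderiv_comp_add_right]

theorem ViscSub.translate (h : ViscSub G A v) (a : Space N) (hG : ∀ x p, G (x + a) p = G x p) :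
    ViscSub G (fun x => A (x + a)) (fun x => v (x + a)) := by
  intro φ x hφ hx
  have h1 := h (fun y => φ (y + -a)) (x + a) (hφ.comp (contDiff_id.add contDiff_const)) ?_
  · rw [gradient_comp_add_right, hG] at h1
    simpa using h1
  · have ht : Tendsto (fun y => y + -a) (𝓝 (x + a)) (𝓝 x) := by
      have : Continuous (fun y : Space N => y + -a) := by fun_prop
      simpa using this.tendsto (x + a)
    have := ht.eventually hx
    filter_upwards [this] with y hy
    simpa using hy

/-- A cone of slope `K' > K` with vertex `x0` cannot touch `v` from above off its vertex, so `v - K'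
‖· - x0‖` is maximal at `x0`; then `K'` decreases to `K`. -/
theorem ViscSub.lipBound (h : ViscSub G A v) (husc : UpperSemicontinuous v)
    (hbdd : ∃ C, ∀ x, v x ≤ C) (hK0 : 0 ≤ K) (hK : ∀ x p, G x p ≤ A x → ‖p‖ ≤ K) :
    LipBound K v := by
  obtain ⟨C, hC⟩ := hbdd
  have key : ∀ K' > K, ∀ x0 y0, v y0 - v x0 ≤ K' * ‖y0 - x0‖ := by
    intro K' hK' x0 y0
    have hK'0 : 0 < K' := hK0.trans_lt hK'
    -- Since `v ≤ C`, a maximum point `y` has `K' ‖y - x0‖ ≤ C - v x0`, so this radius keeps it off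
    -- the boundary sphere.
    set R := ‖y0 - x0‖ + |C - v x0| / K' + 1 with hR
    have hq : 0 ≤ |C - v x0| / K' := by positivity
    have hR0 : 0 < R := by positivity
    have husc' : UpperSemicontinuousOn (fun y => v y + - (K' * ‖y - x0‖))
        (Metric.closedBall x0 R) := by
      have hc : Continuous fun y : Space N => - (K' * ‖y - x0‖) := by fun_prop
      exact (husc.add hc.upperSemicontinuous).upperSemicontinuousOn _
    obtain ⟨y, hy, hmax⟩ := husc'.exists_isMaxOn ⟨x0, Metric.mem_closedBall_self hR0.le⟩
      (isCompact_closedBall x0 R)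
    have hx0 := hmax (Metric.mem_closedBall_self hR0.le)
    have hy0 := hmax (show y0 ∈ Metric.closedBall x0 R by
      rw [Metric.mem_closedBall, dist_eq_norm]; linarith)
    simp only [mem_ofPred_eq, sub_self, norm_zero, mul_zero, neg_zero, add_zero] at hx0 hy0
    by_cases hyx : y = x0
    · subst hyx
      simp only [sub_self, norm_zero, mul_zero, neg_zero, add_zero] at hy0
      linarith
    exfalso
    have hlt : y ∈ Metric.ball x0 R := by
      rw [Metric.mem_ball, dist_eq_norm]
      have h1 : K' * ‖y - x0‖ ≤ C - v x0 := by linarith [hC y]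
      have h2 : ‖y - x0‖ ≤ |C - v x0| / K' := by
        rw [le_div_iff₀ hK'0]
        linarith [le_abs_self (C - v x0)]
      linarith [norm_nonneg (y0 - x0)]
    have hloc : IsLocalMax (fun z => v z - K' * ‖z - x0‖) y := by
      filter_upwards [Metric.isOpen_ball.mem_nhds hlt] with z hz
      have := hmax (Metric.ball_subset_closedBall hz)
      simp only [mem_ofPred_eq] at this
      linarith
    have hsm : ContDiffAt ℝ 1 (fun z : Space N => K' * ‖z - x0‖) y :=
      contDiffAt_const.mul ((contDiffAt_id.sub contDiffAt_const).norm ℝ (sub_ne_zero.2 hyx))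
    have := hK _ _ (h.le_of_contDiffAt hsm hloc)
    rw [norm_gradient_const_mul_norm hK'0.le hyx] at this
    linarith
  intro x y
  have ht : Tendsto (fun K' : ℝ => K' * ‖x - y‖) (𝓝[>] K) (𝓝 (K * ‖x - y‖)) :=
    ((continuous_id.mul continuous_const).tendsto K).mono_left nhdsWithin_le_nhds
  refine ge_of_tendsto ht ?_
  filter_upwards [self_mem_nhdsWithin] with K' hK'
  exact key K' hK' y x

end ViscSub

/-! ### Pointwise sign, comparison and stability under suprema. -/

section ViscSub

variable {N : ℕ} {G : Space N → Space N → ℝ} {A B v w : Space N → ℝ} {K : ℝ}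

/-- Steep paraboloids touch `v` from above at points arbitrarily close to `x`, and `0 ≤ G ≤ A` at
such points. -/
theorem ViscSub.nonneg (h : ViscSub G A v) (hv : Continuous v) (hA : Continuous A)
    (hG : ∀ x p, 0 ≤ G x p) (x : Space N) : 0 ≤ A x := by
  by_contra! hneg
  obtain ⟨ε, hε, hball⟩ := Metric.eventually_nhds_iff.1 ((hA.tendsto x).eventually_lt_const hneg)
  obtain ⟨C, hC⟩ := ((isCompact_closedBall x ε).image hv).bddAbove
  set n := (|C - v x| + 1) / ε ^ 2 with hn
  have hc : Continuous fun y => v y - n * ‖y - x‖ ^ 2 := by fun_prop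
  obtain ⟨y, hy, hmax⟩ := (isCompact_closedBall x ε).exists_isMaxOn
    ⟨x, Metric.mem_closedBall_self hε.le⟩ hc.continuousOn
  have hx := hmax (Metric.mem_closedBall_self hε.le)
  simp only [mem_ofPred_eq, sub_self, norm_zero] at hx
  have hlt : y ∈ Metric.ball x ε := by
    rw [Metric.mem_ball]
    refine lt_of_le_of_ne hy fun heq => ?_
    rw [dist_eq_norm] at heq
    rw [heq, hn, div_mul_cancel₀ _ (by positivity)] at hx
    have := hC (mem_image_of_mem v hy)
    have := le_abs_self (C - v x)
    linarith
  have hloc : IsLocalMax (fun y => v y - n * ‖y - x‖ ^ 2) y := by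
    filter_upwards [Metric.isOpen_ball.mem_nhds hlt] with z hz
    exact hmax (Metric.ball_subset_closedBall hz)
  have h1 := h _ y (contDiff_norm_sub_sq n x) hloc
  have h2 := hball hlt
  have h3 := hG y (gradient (fun y => n * ‖y - x‖ ^ 2) y)
  linarith

/-- Doubling of variables at a maximum point of `a - b`. -/
theorem ViscSub.comparison_at_max {a b : Space N → ℝ} (ha : ViscSub G A a) (hb : ViscSuper G B b)
    (haL : LipBound K a) (hK : 0 ≤ K) (hbc : Continuous b)
    (hG : Continuous fun z : Space N × Space N => G z.1 z.2) (hA : Continuous A)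
    (hB : Continuous B) {x₀ : Space N} (hmax : ∀ y, a y - b y ≤ a x₀ - b x₀) :
    B x₀ ≤ A x₀ := by
  by_contra! hlt
  have hac := haL.continuous
  -- If `A x₀ < B x₀`, the two equations are incompatible near `x₀` for almost equal momenta,
  -- uniformly for momenta in a compact ball.
  have hev : ∀ᶠ z : Space N × Space N × Space N in 𝓝 (x₀, x₀, 0),
      ∀ q ∈ Metric.closedBall (0 : Space N) (2 * K),
        G z.2.1 q - B z.2.1 < G z.1 (q + z.2.2) - A z.1 := by
    refine (isCompact_closedBall _ _).eventually_forall_of_forall_eventually fun q _ => ?_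
    have h1 : Continuous fun z : (Space N × Space N × Space N) × Space N =>
        G z.1.2.1 z.2 - B z.1.2.1 :=
      (hG.comp (by fun_prop : Continuous fun z : (Space N × Space N × Space N) × Space N =>
        (z.1.2.1, z.2))).sub (hB.comp (by fun_prop))
    have h2 : Continuous fun z : (Space N × Space N × Space N) × Space N =>
        G z.1.1 (z.2 + z.1.2.2) - A z.1.1 :=
      (hG.comp (by fun_prop : Continuous fun z : (Space N × Space N × Space N) × Space N =>
        (z.1.1, z.2 + z.1.2.2))).sub (hA.comp (by fun_prop))
    exact h1.continuousAt.eventually_lt h2.continuousAt (by simpa using hlt)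
  obtain ⟨ε', hε', hball'⟩ := Metric.eventually_nhds_iff.1 hev
  obtain ⟨ε, hε, hε1, hball⟩ : ∃ ε > 0, ε < 1 ∧ ∀ x y r : Space N, ‖x - x₀‖ < ε → ‖y - x₀‖ < ε →
      ‖r‖ < ε → ∀ q ∈ Metric.closedBall (0 : Space N) (2 * K),
        G y q - B y < G x (q + r) - A x := by
    refine ⟨min ε' (1 / 2), by positivity, by
      have := min_le_right ε' (1 / 2); linarith, fun x y r hx hy hr => ?_⟩
    have := min_le_left ε' (1 / 2)
    refine hball' (y := (x, y, r)) ?_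
    simp only [Prod.dist_eq, max_lt_iff]
    simp only [dist_eq_norm, sub_zero]
    exact ⟨by linarith, by linarith, by linarith⟩
  clear hball' hev
  -- These two conditions will give `‖x - y‖ < ε / 2` and `‖x - x₀‖ < ε / 2`. The term `‖x - x₀‖ ^
  -- 2` in the penalty localises at the given maximum point, which need not be strict.
  obtain ⟨n, hn0, hn1, hn2⟩ : ∃ n : ℝ, 0 < n ∧ K / n < ε / 2 ∧ K ^ 2 / n < (ε / 2) ^ 2 := by
    have t1 : Tendsto (fun n : ℝ => K / n) atTop (𝓝 0) := tendsto_const_nhds.div_atTop tendsto_id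
    have t2 : Tendsto (fun n : ℝ => K ^ 2 / n) atTop (𝓝 0) :=
      tendsto_const_nhds.div_atTop tendsto_id
    exact ((eventually_gt_atTop 0).and ((t1.eventually_lt_const (by positivity)).and
      (t2.eventually_lt_const (by positivity)))).exists
  have hc : Continuous fun z : Space N × Space N =>
      a z.1 - b z.2 - n * ‖z.1 - z.2‖ ^ 2 - ‖z.1 - x₀‖ ^ 2 := by fun_prop
  have h0 : x₀ ∈ Metric.closedBall x₀ 1 := Metric.mem_closedBall_self zero_le_one
  obtain ⟨⟨x, y⟩, hxy, hm⟩ :=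
    ((isCompact_closedBall x₀ 1).prod (isCompact_closedBall x₀ 1)).exists_isMaxOn
      ⟨(x₀, x₀), ⟨h0, h0⟩⟩ hc.continuousOn
  have hm0 := hm (show (x₀, x₀) ∈ _ from ⟨h0, h0⟩)
  simp only [mem_ofPred_eq, sub_self, norm_zero] at hm0
  have e1 := hmax y
  have e2 := haL x y
  -- Maximality of `x₀` for `a - b` leaves only `a x - a y` against the penalty. The Lipschitz bound
  -- on `a` then controls `n ‖x - y‖`, hence the momentum `q`.
  have e3 : n * ‖x - y‖ ^ 2 + ‖x - x₀‖ ^ 2 ≤ K * ‖x - y‖ := by linarith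
  have hnn := norm_nonneg (x - y)
  have e4 : n * ‖x - y‖ ≤ K := by
    rcases hnn.eq_or_lt with h | h
    · rw [← h]; simpa using hK
    · refine le_of_mul_le_mul_right ?_ h
      nlinarith [sq_nonneg ‖x - x₀‖]
  have e5 : ‖x - y‖ ≤ K / n := by rw [le_div_iff₀ hn0]; linarith
  have e6 : ‖x - x₀‖ ^ 2 ≤ K ^ 2 / n := by
    have : K * ‖x - y‖ ≤ K * (K / n) := mul_le_mul_of_nonneg_left e5 hK
    have h3 : K * (K / n) = K ^ 2 / n := by ring
    nlinarith [mul_nonneg hn0.le (sq_nonneg ‖x - y‖)]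
  have e7 : ‖x - x₀‖ < ε / 2 := lt_of_pow_lt_pow_left₀ 2 (by positivity) (e6.trans_lt hn2)
  have e8 : ‖y - x₀‖ < ε := by
    have := norm_sub_le_norm_sub_add_norm_sub y x x₀
    rw [norm_sub_rev y x] at this
    linarith
  have hxb : x ∈ Metric.ball x₀ 1 := by rw [Metric.mem_ball, dist_eq_norm]; linarith
  have hyb : y ∈ Metric.ball x₀ 1 := by rw [Metric.mem_ball, dist_eq_norm]; linarith
  set q : Space N := (2 * n) • (x - y) with hq
  have hqK : q ∈ Metric.closedBall (0 : Space N) (2 * K) := by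
    rw [mem_closedBall_zero_iff, hq, norm_smul, Real.norm_of_nonneg (by positivity)]
    linarith
  have hr : ‖(2 * (1 : ℝ)) • (x - x₀)‖ < ε := by
    rw [norm_smul, Real.norm_of_nonneg (by positivity)]
    linarith
  have hmain := hball x y _ (by linarith) e8 hr q hqK
  have t1 : G x (q + (2 * (1 : ℝ)) • (x - x₀)) ≤ A x := by
    have hg := hasGradientAt_add (hasGradientAt_norm_sq n y x) (hasGradientAt_norm_sq 1 x₀ x)
    rw [hq, ← hg.gradient]
    refine ha _ x ((contDiff_norm_sub_sq n y).add (contDiff_norm_sub_sq 1 x₀)) ?_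
    filter_upwards [Metric.isOpen_ball.mem_nhds hxb] with z hz
    have := hm (show (z, y) ∈ _ from ⟨Metric.ball_subset_closedBall hz, hxy.2⟩)
    simp only [mem_ofPred_eq] at this
    linarith
  have t2 : B y ≤ G y q := by
    have hg := hasGradientAt_norm_sq (-n) x y
    have hqe : q = (2 * (-n)) • (y - x) := by rw [hq]; module
    rw [hqe, ← hg.gradient]
    refine hb _ y (contDiff_norm_sub_sq (-n) x) ?_
    filter_upwards [Metric.isOpen_ball.mem_nhds hyb] with z hz
    have := hm (show (x, z) ∈ _ from ⟨hxy.1, Metric.ball_subset_closedBall hz⟩)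
    simp only [mem_ofPred_eq] at this
    rw [norm_sub_rev z x, norm_sub_rev y x]
    linarith
  linarith

/-- Stability of subsolutions under suprema. The term `d * (w - v k)` accounts for a dependence of
the equation on the unknown. -/
theorem ViscSub.iSup {ι : Type*} {v : ι → Space N → ℝ} {d : Space N → ℝ}
    (hG : Continuous fun z : Space N × Space N => G z.1 z.2) (hA : Continuous A)
    (hd : Continuous d) (hK : 0 ≤ K) (hL : ∀ k, LipBound K (v k))
    (hv : ∀ k, ViscSub G (fun x => A x + d x * (w x - v k x)) (v k))
    (hub : ∀ k x, v k x ≤ w x) (hlub : ∀ x, ∀ ε > 0, ∃ k, w x - ε < v k x) :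
    ViscSub G A w := by
  intro φ x hφ hx
  by_contra! hlt
  have hw : LipBound K w := LipBound.iSup hL hub hlub
  have hgc := contDiff_continuous_gradient hφ
  have hev : ∀ᶠ z : Space N × ℝ in 𝓝 (x, 0),
      A z.1 + d z.1 * z.2 < G z.1 (gradient φ z.1 + (2 * (1 : ℝ)) • (z.1 - x)) := by
    have h1 : Continuous fun z : Space N × ℝ => A z.1 + d z.1 * z.2 := by fun_prop
    have h2 : Continuous fun z : Space N × ℝ =>
        G z.1 (gradient φ z.1 + (2 * (1 : ℝ)) • (z.1 - x)) :=
      hG.comp (by fun_prop : Continuous fun z : Space N × ℝ =>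
        (z.1, gradient φ z.1 + (2 * (1 : ℝ)) • (z.1 - x)))
    exact h1.continuousAt.eventually_lt h2.continuousAt (by simpa using hlt)
  obtain ⟨ε, hε, hball⟩ := Metric.eventually_nhds_iff.1 hev
  obtain ⟨ρ, hρ, hmaxball⟩ := Metric.eventually_nhds_iff.1 hx
  -- With `w x - v k x < δ ^ 2` the perturbed maximum lies strictly inside the `δ`-ball, and the
  -- Lipschitz bounds give `w - v k ≤ δ ^ 2 + 2 K δ` at that point.
  obtain ⟨δ, hδ0, hδρ, hδε, hδε'⟩ : ∃ δ > 0, δ < ρ ∧ δ < ε ∧ δ ^ 2 + 2 * K * δ < ε := by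
    have t : Tendsto (fun δ : ℝ => δ ^ 2 + 2 * K * δ) (𝓝[>] 0) (𝓝 0) := by
      have hc : Continuous fun δ : ℝ => δ ^ 2 + 2 * K * δ := by fun_prop
      simpa using (hc.tendsto 0).mono_left nhdsWithin_le_nhds
    have t' : Tendsto (fun δ : ℝ => δ) (𝓝[>] 0) (𝓝 0) := nhdsWithin_le_nhds
    obtain ⟨δ, h1, h2, h3, h4⟩ := ((eventually_mem_nhdsWithin (a := (0 : ℝ)) (s := Ioi 0)).and ((t'.eventually_lt_const hρ).and
      ((t'.eventually_lt_const hε).and (t.eventually_lt_const hε)))).exists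
    exact ⟨δ, h1, h2, h3, h4⟩
  obtain ⟨k, hk⟩ := hlub x (δ ^ 2) (by positivity)
  have hc : Continuous fun y => v k y - (φ y + 1 * ‖y - x‖ ^ 2) := by
    have := (hL k).continuous
    have := hφ.continuous
    fun_prop
  obtain ⟨y, hy, hmax⟩ := (isCompact_closedBall x δ).exists_isMaxOn
    ⟨x, Metric.mem_closedBall_self hδ0.le⟩ hc.continuousOn
  have hmx := hmax (Metric.mem_closedBall_self hδ0.le)
  simp only [mem_ofPred_eq, sub_self, norm_zero] at hmx
  have hyδ : ‖y - x‖ ≤ δ := by rw [← dist_eq_norm]; exact hy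
  have hwy := hmaxball (y := y) (by rw [dist_eq_norm]; linarith)
  have hlt' : ‖y - x‖ < δ := by
    refine lt_of_pow_lt_pow_left₀ 2 hδ0.le ?_
    have := hub k y
    simp only at hwy
    linarith
  have hloc : IsLocalMax (fun y => v k y - (φ y + 1 * ‖y - x‖ ^ 2)) y := by
    have : y ∈ Metric.ball x δ := by rw [Metric.mem_ball, dist_eq_norm]; exact hlt'
    filter_upwards [Metric.isOpen_ball.mem_nhds this] with z hz
    exact hmax (Metric.ball_subset_closedBall hz)
  have h1 := hv k _ y (hφ.add (contDiff_norm_sub_sq 1 x)) hloc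
  have hgr := hasGradientAt_add (contDiff_hasGradientAt hφ y) (hasGradientAt_norm_sq 1 x y)
  rw [hgr.gradient] at h1
  have hd1 : w y - v k y < ε := by
    have a1 := hw y x
    have a2 := hL k x y
    rw [norm_sub_rev] at a2
    nlinarith [norm_nonneg (y - x)]
  have h2 := hball (y := (y, w y - v k y)) (by
    simp only [Prod.dist_eq, max_lt_iff]
    simp only [dist_eq_norm, sub_zero]
    refine ⟨by linarith, ?_⟩
    rw [Real.norm_of_nonneg (sub_nonneg.2 (hub k y))]
    exact hd1)
  simp only at h2
  linarith

end ViscSub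

/-! ### Convexity: testing subsolutions from below. -/

section Flip

variable {N : ℕ} {G : Space N → Space N → ℝ} {A v : Space N → ℝ} {K : ℝ}

/-- A Lipschitz function all of whose touching gradients `p` near `x₀` satisfy `⟪e, p⟫ ≤ β`
grows at most with slope `β` in the direction `e`. -/
theorem le_add_of_inner_gradient_le (hL : LipBound K v) (hK : 0 ≤ K) {x₀ e : Space N}
    (he : ‖e‖ = 1) {β b : ℝ} (hb : β < b)
    (h : ∀ᶠ x in 𝓝 x₀, ∀ φ : Space N → ℝ, ContDiff ℝ 1 φ → IsLocalMax (fun y => v y - φ y) x →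
      inner ℝ e (gradient φ x) ≤ β) :
    ∃ t₁ > 0, ∃ a, ∀ t, 0 ≤ t → t ≤ t₁ → v (x₀ + t • e) ≤ v x₀ + b * t + a * t ^ 2 := by
  obtain ⟨ε, hε, hball⟩ := Metric.eventually_nhds_iff.1 h
  set ρ := ε / 2 with hρ
  have hρ0 : 0 < ρ := by positivity
  set t₁ := ρ / 2 with ht₁
  have ht₁0 : 0 < t₁ := by positivity
  obtain ⟨a, ha0, ha⟩ : ∃ a > 0, K * ρ + |b| * ρ < a * t₁ ^ 2 := by
    refine ⟨(K * ρ + |b| * ρ + 1) / t₁ ^ 2, by positivity, ?_⟩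
    rw [div_mul_cancel₀ _ (by positivity)]
    linarith
  refine ⟨t₁, ht₁0, a, fun t ht htt => ?_⟩
  have key : ∀ᶠ n : ℝ in atTop, v (x₀ + t • e) - (b * t + a * t ^ 2) ≤ v x₀ + K ^ 2 / (4 * n) := by
    filter_upwards [eventually_gt_atTop 0,
      eventually_gt_atTop ((K * ρ + |b| * ρ) / (3 / 4 * ρ ^ 2))] with n hn0 hn
    rw [div_lt_iff₀ (by positivity)] at hn
    set s : Space N → ℝ := fun x => inner ℝ e (x - x₀) with hs
    have hs_le : ∀ x, |s x| ≤ ‖x - x₀‖ := fun x => by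
      have := abs_real_inner_le_norm e (x - x₀)
      rwa [he, one_mul] at this
    have hsc : Continuous s := by fun_prop
    -- Barrier on a slab of a ball, `s` being the coordinate along `e`. An interior maximum of `v -
    -- ψ` would have slope `b + 2 a s > β`. The face `s = t₁` is excluded by the size of `a`, and
    -- the sphere by that of `n`, since `s ≤ ρ / 2` there. On the face `s = 0` the loss is at most
    -- `K r - n r ^ 2 ≤ K ^ 2 / (4 n)`, which vanishes as `n → ∞`.
    set ψ : Space N → ℝ := fun x => b * s x + a * s x ^ 2 + n * (‖x - x₀‖ ^ 2 - s x ^ 2) with hψ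
    have hcpt : IsCompact (Metric.closedBall x₀ ρ ∩ {x | 0 ≤ s x ∧ s x ≤ t₁}) :=
      (isCompact_closedBall x₀ ρ).inter_right
        ((isClosed_le continuous_const hsc).inter (isClosed_le hsc continuous_const))
    have hst : s (x₀ + t • e) = t := by simp [hs, inner_smul_right, he]
    have hmem : x₀ + t • e ∈ Metric.closedBall x₀ ρ ∩ {x | 0 ≤ s x ∧ s x ≤ t₁} := by
      refine ⟨?_, by rw [mem_ofPred_eq, hst]; exact ⟨ht, htt⟩⟩
      rw [Metric.mem_closedBall, dist_eq_norm, add_sub_cancel_left, norm_smul, he,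
        Real.norm_of_nonneg ht]
      linarith
    have hc : Continuous fun x => v x - ψ x := by
      have := hL.continuous
      fun_prop
    obtain ⟨y, ⟨hyb, hy0, hy1⟩, hmax⟩ := hcpt.exists_isMaxOn ⟨_, hmem⟩ hc.continuousOn
    have hle := hmax hmem
    have hψt : ψ (x₀ + t • e) = b * t + a * t ^ 2 := by
      rw [hψ]
      simp only [hst, add_sub_cancel_left, norm_smul, he, Real.norm_of_nonneg ht]
      ring
    simp only [mem_ofPred_eq, hψt] at hle
    refine hle.trans ?_
    have hyx := hL y x₀
    have hyb' : ‖y - x₀‖ ≤ ρ := by rw [← dist_eq_norm]; exact hyb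
    have hsy := hs_le y
    rw [abs_of_nonneg hy0] at hsy
    have hr0 := norm_nonneg (y - x₀)
    rcases hy0.eq_or_lt with hy0' | hy0'
    · have hψy : ψ y = n * ‖y - x₀‖ ^ 2 := by
        simp only [hψ, ← hy0']; ring
      rw [hψy]
      have : K * ‖y - x₀‖ - n * ‖y - x₀‖ ^ 2 ≤ K ^ 2 / (4 * n) := by
        rw [le_div_iff₀ (by positivity)]
        nlinarith [sq_nonneg (2 * n * ‖y - x₀‖ - K)]
      linarith
    have hKρ : K * ‖y - x₀‖ ≤ K * ρ := mul_le_mul_of_nonneg_left hyb' hK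
    have hbs : -(b * s y) ≤ |b| * ρ := by
      have h1 := neg_abs_le b
      have h2 : -|b| * s y ≤ b * s y := mul_le_mul_of_nonneg_right h1 hy0
      have h3 : |b| * s y ≤ |b| * ρ := mul_le_mul_of_nonneg_left (hsy.trans hyb') (abs_nonneg b)
      linarith
    have hP : 0 ≤ ‖y - x₀‖ ^ 2 - s y ^ 2 := by nlinarith
    by_cases hin : ‖y - x₀‖ < ρ ∧ s y < t₁
    · exfalso
      have hloc : IsLocalMax (fun x => v x - ψ x) y := by
        have o1 : ∀ᶠ z in 𝓝 y, ‖z - x₀‖ < ρ :=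
          (by fun_prop : Continuous fun z : Space N => ‖z - x₀‖).continuousAt.eventually_lt_const
            hin.1
        filter_upwards [o1, hsc.continuousAt.eventually_lt_const hin.2,
          hsc.continuousAt.eventually_const_lt hy0'] with z h1 h2 h3
        exact hmax ⟨by rw [Metric.mem_closedBall, dist_eq_norm]; exact h1.le, h3.le, h2.le⟩
      have hsm : ContDiff ℝ 1 ψ := by
        have h1 : ContDiff ℝ 1 s := (contDiff_const (c := e)).inner ℝ (contDiff_id.sub contDiff_const)
        have h2 : ContDiff ℝ 1 fun x : Space N => ‖x - x₀‖ ^ 2 :=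
          (contDiff_id.sub contDiff_const).norm_sq ℝ
        exact ((contDiff_const.mul h1).add (contDiff_const.mul (h1.pow 2))).add
          (contDiff_const.mul (h2.sub (h1.pow 2)))
      have h1 := hball (y := y) (by rw [dist_eq_norm]; linarith) ψ hsm hloc
      have hds : HasFDerivAt s (InnerProductSpace.toDual ℝ (Space N) e) y :=
        hasGradientAt_iff_hasFDerivAt.1 (hasGradientAt_inner e x₀ y)
      have hdn : HasFDerivAt (fun x : Space N => 1 * ‖x - x₀‖ ^ 2)
          (InnerProductSpace.toDual ℝ (Space N) ((2 * (1 : ℝ)) • (y - x₀))) y :=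
        hasGradientAt_iff_hasFDerivAt.1 (hasGradientAt_norm_sq 1 x₀ y)
      simp only [one_mul] at hdn
      have hdψ := ((hds.const_mul b).add ((hds.pow 2).const_mul a)).add
        ((hdn.sub (hds.pow 2)).const_mul n)
      have h2 : inner ℝ e (gradient ψ y) = b + 2 * a * s y := by
        have hdψ' : fderiv ℝ ψ y e = _ := congrArg (· e) (HasFDerivAt.fderiv (f := ψ) hdψ)
        rw [real_inner_comm, inner_gradient_left, hdψ']
        have hye : inner ℝ (y - x₀) e = s y := real_inner_comm _ _
        simp [he, hye, -map_sub]
        ring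
      rw [h2] at h1
      nlinarith [mul_pos ha0 hy0']
    have hvx : v y - v x₀ - ψ y ≤ K * ‖y - x₀‖ + |b| * ρ - a * s y ^ 2
        - n * (‖y - x₀‖ ^ 2 - s y ^ 2) := by
      simp only [hψ]; linarith
    have hnP : 0 ≤ n * (‖y - x₀‖ ^ 2 - s y ^ 2) := mul_nonneg hn0.le hP
    have hq : 0 ≤ K ^ 2 / (4 * n) := by positivity
    rcases not_and_or.1 hin with h1 | h1
    · have h1' : ‖y - x₀‖ = ρ := le_antisymm hyb' (not_lt.1 h1)
      have h2 : s y ^ 2 ≤ (ρ / 2) ^ 2 := pow_le_pow_left₀ hy0 hy1 2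
      have h3 : n * (3 / 4 * ρ ^ 2) ≤ n * (‖y - x₀‖ ^ 2 - s y ^ 2) := by
        refine mul_le_mul_of_nonneg_left ?_ hn0.le
        rw [h1']; linarith
      have h4 : 0 ≤ a * s y ^ 2 := by positivity
      linarith
    · have h1' : s y = t₁ := le_antisymm hy1 (not_lt.1 h1)
      rw [h1'] at hvx hnP
      linarith
  have hlim : Tendsto (fun n : ℝ => v x₀ + K ^ 2 / (4 * n)) atTop (𝓝 (v x₀ + 0)) :=
    tendsto_const_nhds.add (tendsto_const_nhds.div_atTop
      (tendsto_id.const_mul_atTop (by norm_num)))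
  have := ge_of_tendsto hlim key
  linarith

/-- For convex Hamiltonians, subsolutions can be tested from below. -/
theorem ViscSub.le_of_isLocalMin (h : ViscSub G A v) (hL : LipBound K v) (hK0 : 0 ≤ K)
    (hG : Continuous fun z : Space N × Space N => G z.1 z.2) (hA : Continuous A)
    (hconv : ∀ x, ConvexOn ℝ univ (G x)) (hK : ∀ x p, G x p ≤ A x → ‖p‖ ≤ K)
    (h0 : ∀ x, G x 0 ≤ A x) {φ : Space N → ℝ} {x₀ p₀ : Space N} (hφ : HasGradientAt φ p₀ x₀)
    (hmin : IsLocalMin (fun y => v y - φ y) x₀) : G x₀ p₀ ≤ A x₀ := by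
  by_contra! hlt
  obtain ⟨η, hη, hlt⟩ : ∃ η > 0, A x₀ + η < G x₀ p₀ :=
    ⟨(G x₀ p₀ - A x₀) / 2, by linarith, by linarith⟩
  have hGx : Continuous (G x₀) := hG.comp (by fun_prop : Continuous fun p : Space N => (x₀, p))
  have hCc : Convex ℝ {p | G x₀ p ≤ A x₀ + η} := by
    have := (hconv x₀).convex_le (A x₀ + η)
    simpa using this
  -- Separate `p₀` from the convex set of almost admissible momenta. Gradients touching `v` from
  -- above near `x₀` lie in the half-space `⟪e, p⟫ ≤ β`, whereas `⟪e, p₀⟫ > β`.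
  obtain ⟨l, u, hl, hu⟩ := geometric_hahn_banach_closed_point hCc
    (isClosed_le hGx continuous_const) (show p₀ ∉ {p | G x₀ p ≤ A x₀ + η} from not_le.2 hlt)
  have hu0 : 0 < u := by
    have := hl 0 (by show G x₀ 0 ≤ A x₀ + η; linarith [h0 x₀])
    simpa using this
  set e' := (InnerProductSpace.toDual ℝ (Space N)).symm l with he'
  have hle : ∀ p, l p = inner ℝ e' p := fun p => by
    rw [he', InnerProductSpace.toDual_symm_apply]
  have hne : 0 < ‖e'‖ := by
    rw [norm_pos_iff]
    intro h
    rw [hle, h, inner_zero_left] at hu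
    linarith
  set e := ‖e'‖⁻¹ • e' with he
  have hen : ‖e‖ = 1 := by
    rw [he, norm_smul, norm_inv, norm_norm, inv_mul_cancel₀ hne.ne']
  have hin : ∀ p, inner ℝ e p = ‖e'‖⁻¹ * l p := fun p => by
    rw [he, real_inner_smul_left, hle]
  set β := ‖e'‖⁻¹ * u with hβ
  have hβ2 : β < inner ℝ e p₀ := by
    rw [hin, hβ]
    exact mul_lt_mul_of_pos_left hu (by positivity)
  have hnear : ∀ᶠ x in 𝓝 x₀, ∀ φ : Space N → ℝ, ContDiff ℝ 1 φ →
      IsLocalMax (fun y => v y - φ y) x → inner ℝ e (gradient φ x) ≤ β := by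
    have hev : ∀ᶠ x in 𝓝 x₀, ∀ p ∈ Metric.closedBall (0 : Space N) K,
        G x₀ p - A x₀ - η < G x p - A x := by
      refine (isCompact_closedBall _ _).eventually_forall_of_forall_eventually fun p _ => ?_
      have h1 : Continuous fun z : Space N × Space N => G x₀ z.2 - A x₀ - η := by fun_prop
      have h2 : Continuous fun z : Space N × Space N => G z.1 z.2 - A z.1 := by fun_prop
      exact h1.continuousAt.eventually_lt h2.continuousAt (by simp only; linarith)
    filter_upwards [hev] with x hx ψ hψ hmax
    have h1 := h ψ x hψ hmax
    have h2 := hx _ (mem_closedBall_zero_iff.2 (hK _ _ h1))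
    have h3 := hl (gradient ψ x) (by show G x₀ _ ≤ _; linarith)
    rw [hin, hβ]
    exact mul_le_mul_of_nonneg_left h3.le (by positivity)
  obtain ⟨b, hb1, hb2⟩ := exists_between hβ2
  obtain ⟨t₁, ht₁, a, ha⟩ := le_add_of_inner_gradient_le hL hK0 hen hb1 hnear
  have hd : HasDerivAt (fun t : ℝ => φ (x₀ + t • e)) (inner ℝ e p₀) 0 := by
    have h1 : HasDerivAt (fun t : ℝ => x₀ + t • e) e 0 := by
      simpa using ((hasDerivAt_id (0 : ℝ)).smul_const e).const_add x₀
    have h2 : HasFDerivAt φ (InnerProductSpace.toDual ℝ (Space N) p₀) (x₀ + (0 : ℝ) • e) := by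
      simpa using hasGradientAt_iff_hasFDerivAt.1 hφ
    have := h2.comp_hasDerivAt (0 : ℝ) h1
    rw [real_inner_comm]
    simpa [Function.comp_def] using this
  have hslope := (hasDerivAt_iff_tendsto_slope_zero.1 hd).mono_left
    (nhdsWithin_mono (0 : ℝ) (fun t (ht : t ∈ Ioi (0 : ℝ)) => ht.ne'))
  have hlim : Tendsto (fun t : ℝ => b + a * t) (𝓝[>] 0) (𝓝 b) := by
    have hc : Continuous fun t : ℝ => b + a * t := by fun_prop
    simpa using (hc.tendsto 0).mono_left nhdsWithin_le_nhds
  have hcont : Tendsto (fun t : ℝ => x₀ + t • e) (𝓝[>] 0) (𝓝 x₀) := by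
    have hc : Continuous fun t : ℝ => x₀ + t • e := by fun_prop
    simpa using (hc.tendsto 0).mono_left nhdsWithin_le_nhds
  -- Along the ray in direction `e`, `v` grows at most with slope `b`, while `φ` touches `v` from
  -- below with slope `⟪e, p₀⟫`.
  have hfin : inner ℝ e p₀ ≤ b := by
    refine le_of_tendsto_of_tendsto hslope hlim ?_
    filter_upwards [hcont.eventually hmin, self_mem_nhdsWithin,
      nhdsWithin_le_nhds (eventually_lt_nhds ht₁)] with t h1 h2 h3
    have h2' : (0 : ℝ) < t := h2
    have h4 := ha t h2'.le h3.le
    simp only [zero_add, zero_smul, add_zero, smul_eq_mul]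
    rw [inv_mul_le_iff₀ h2']
    nlinarith
  linarith

/-- For convex Hamiltonians, `v` is a subsolution of `G(x, Dv) ≤ A(x)` only if `c - v` is one of
`G(x, -Dv) ≤ A(x)`. -/
theorem ViscSub.const_sub (h : ViscSub G A v) (hL : LipBound K v) (hK0 : 0 ≤ K)
    (hG : Continuous fun z : Space N × Space N => G z.1 z.2) (hA : Continuous A)
    (hconv : ∀ x, ConvexOn ℝ univ (G x)) (hK : ∀ x p, G x p ≤ A x → ‖p‖ ≤ K)
    (h0 : ∀ x, G x 0 ≤ A x) (c : ℝ) :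
    ViscSub (fun x p => G x (-p)) A (fun x => c - v x) := by
  intro φ x hφ hmax
  refine h.le_of_isLocalMin hL hK0 hG hA hconv hK h0
    (hasGradientAt_neg (contDiff_hasGradientAt hφ x)) ?_
  filter_upwards [hmax] with y hy
  linarith

end Flip

/-! ### Irreducible matrices with zero row sums. -/

section Matrix

variable {m : ℕ} {A : Matrix (Fin m) (Fin m) ℝ}

/-- Strong maximum principle for irreducible matrices with zero row sums. -/
theorem eq_max_of_sum_nonpos (hoff : ∀ i j, i ≠ j → A i j ≤ 0) (hrow : ∀ i, ∑ j, A i j = 0)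
    (hirr : IsIrreducibleMatrix A) {w : Fin m → ℝ} {M : ℝ} (hw : ∀ i, w i ≤ M)
    (hne : ∃ i, w i = M) (h : ∀ i, w i = M → ∑ j, A i j * w j ≤ 0) : ∀ i, w i = M := by
  by_contra! hcon
  obtain ⟨l, hl⟩ := hcon
  obtain ⟨i, hi, j, hj, hij⟩ := hirr {i | w i = M} hne fun h => hl (by
    have : l ∈ {i | w i = M} := h ▸ mem_univ l
    exact this)
  have hi' : w i = M := hi
  -- Zero row sums allow subtracting `M`. Every term is then nonnegative, so each vanishes,
  -- including the one coupling `i` to `j`.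
  have hsum : ∑ j, A i j * (w j - M) ≤ 0 := by
    simp only [mul_sub, Finset.sum_sub_distrib, ← Finset.sum_mul, hrow i]
    linarith [h i hi']
  have hnn : ∀ k ∈ Finset.univ, 0 ≤ A i k * (w k - M) := by
    intro k _
    by_cases hk : i = k
    · rw [← hk, hi', sub_self, mul_zero]
    · exact mul_nonneg_of_nonpos_of_nonpos (hoff i k hk) (by linarith [hw k])
  have h0 := (Finset.sum_eq_zero_iff_of_nonneg hnn).1
    (le_antisymm hsum (Finset.sum_nonneg hnn)) j (Finset.mem_univ j)
  rcases mul_eq_zero.1 h0 with h1 | h1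
  · exact hij h1
  · exact hj (by show w j = M; linarith)

theorem eq_of_sum_nonpos (hoff : ∀ i j, i ≠ j → A i j ≤ 0) (hrow : ∀ i, ∑ j, A i j = 0)
    (hirr : IsIrreducibleMatrix A) {w : Fin m → ℝ} (h : ∀ i, ∑ j, A i j * w j ≤ 0) (i j : Fin m) :
    w i = w j := by
  have : Nonempty (Fin m) := ⟨i⟩
  obtain ⟨l, hl⟩ := Finite.exists_max w
  have := eq_max_of_sum_nonpos hoff hrow hirr hl ⟨l, rfl⟩ fun i _ => h i
  rw [this i, this j]

theorem det_eq_zero_of_rowSum (hm : 0 < m) (hrow : ∀ i, ∑ j, A i j = 0) : A.det = 0 := by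
  refine Matrix.exists_mulVec_eq_zero_iff.1 ⟨fun _ => 1, ?_, ?_⟩
  · intro h
    exact one_ne_zero (congrFun h ⟨0, hm⟩)
  · ext i
    simpa [Matrix.mulVec, dotProduct] using hrow i

/-- The entry is the determinant of `A` with row `j` replaced by the unit vector. A kernel vector
vanishes at `j`, so a positive maximum would lie off `j`, and the strong maximum principle would
spread it to `j`. The same applies to its negative. -/
theorem adjugate_diag_ne_zero (hoff : ∀ i j, i ≠ j → A i j ≤ 0) (hrow : ∀ i, ∑ j, A i j = 0)
    (hirr : IsIrreducibleMatrix A) (j : Fin m) : A.adjugate j j ≠ 0 := by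
  rw [Matrix.adjugate_apply]
  intro h0
  obtain ⟨v, hv, hv0⟩ := Matrix.exists_mulVec_eq_zero_iff.2 h0
  have hj : v j = 0 := by
    have := congrFun hv0 j
    simpa [Matrix.mulVec] using this
  have hi : ∀ i, i ≠ j → ∑ k, A i k * v k = 0 := by
    intro i hij
    have := congrFun hv0 i
    simpa [Matrix.mulVec, dotProduct, Matrix.updateRow_ne hij] using this
  have key : ∀ v : Fin m → ℝ, v j = 0 → (∀ i, i ≠ j → ∑ k, A i k * v k = 0) → ∀ i, v i ≤ 0 := by
    intro v hj hi
    have : Nonempty (Fin m) := ⟨j⟩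
    obtain ⟨l, hl⟩ := Finite.exists_max v
    by_contra! hpos
    obtain ⟨i₁, hi₁⟩ := hpos
    have hl0 : 0 < v l := hi₁.trans_le (hl i₁)
    have := eq_max_of_sum_nonpos hoff hrow hirr hl ⟨l, rfl⟩ (fun i hil => (hi i (by
      rintro rfl
      linarith)).le) j
    linarith
  refine hv (funext fun i => le_antisymm (key v hj hi i) ?_)
  have := key (fun i => - v i) (by simp [hj]) (fun i hij => by simp [hi i hij]) i
  simpa using this

/-- As `A * adjugate A = 0`, the columns of the adjugate are constant, so each of its rows is its
diagonal, a left null vector. Absolute values avoid determining the sign: they give a vector whose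
product with `A` is nonpositive, and its entries sum to zero because the row sums of `A` vanish. -/
theorem abs_adjugate_diag_mulVec (hm : 0 < m) (hoff : ∀ i j, i ≠ j → A i j ≤ 0)
    (hrow : ∀ i, ∑ j, A i j = 0) (hirr : IsIrreducibleMatrix A) :
    A.transpose.mulVec (fun j => |A.adjugate j j|) = 0 := by
  have hdet := det_eq_zero_of_rowSum hm hrow
  have hcol : ∀ i j k, A.adjugate i k = A.adjugate j k := by
    intro i j k
    refine eq_of_sum_nonpos hoff hrow hirr (w := fun l => A.adjugate l k) (fun l => ?_) i j
    have := congrFun (congrFun A.mul_adjugate l) k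
    rw [hdet, zero_smul, Matrix.mul_apply] at this
    exact this.le
  have hrow' : ∀ j, ∑ i, A.adjugate i i * A i j = 0 := by
    intro j
    have := congrFun (congrFun A.adjugate_mul ⟨0, hm⟩) j
    rw [hdet, zero_smul, Matrix.mul_apply] at this
    simp only [fun i => hcol ⟨0, hm⟩ i i] at this
    exact this
  have hle : ∀ j, ∑ i, |A.adjugate i i| * A i j ≤ 0 := by
    intro j
    have h1 := hrow' j
    rw [← Finset.add_sum_erase _ _ (Finset.mem_univ j)] at h1 ⊢
    have hjj : 0 ≤ A j j := by
      have := hrow j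
      rw [← Finset.add_sum_erase _ _ (Finset.mem_univ j)] at this
      have h2 : ∑ k ∈ Finset.univ.erase j, A j k ≤ 0 :=
        Finset.sum_nonpos fun k hk => hoff j k (Finset.ne_of_mem_erase hk).symm
      linarith
    have h3 : |A.adjugate j j| * A j j = |∑ k ∈ Finset.univ.erase j, A.adjugate k k * A k j| := by
      rw [show ∑ k ∈ Finset.univ.erase j, A.adjugate k k * A k j = -(A.adjugate j j * A j j) by
        linarith, abs_neg, abs_mul, abs_of_nonneg hjj]
    have h4 := Finset.abs_sum_le_sum_abs (fun k => A.adjugate k k * A k j) (Finset.univ.erase j)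
    have h5 : ∑ k ∈ Finset.univ.erase j, |A.adjugate k k * A k j|
        = - ∑ k ∈ Finset.univ.erase j, |A.adjugate k k| * A k j := by
      rw [← Finset.sum_neg_distrib]
      refine Finset.sum_congr rfl fun k hk => ?_
      rw [abs_mul, abs_of_nonpos (hoff k j (Finset.ne_of_mem_erase hk))]
      ring
    linarith
  have htot : ∑ j, ∑ i, |A.adjugate i i| * A i j = 0 := by
    rw [Finset.sum_comm]
    simp only [← Finset.mul_sum, hrow, mul_zero, Finset.sum_const_zero]
  have hz := (Finset.sum_eq_zero_iff_of_nonpos fun j _ => hle j).1 htot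
  ext j
  have := hz j (Finset.mem_univ j)
  simpa [Matrix.mulVec, dotProduct, mul_comm] using this

end Matrix

/-! ### Compactness of the torus. -/

section Periodic

variable {N m : ℕ}

theorem exists_norm_add_latticeVec_le (x : Space N) :
    ∃ k : Fin N → ℤ, ‖x + latticeVec k‖ ≤ √N := by
  refine ⟨fun a => -⌊x a⌋, ?_⟩
  rw [EuclideanSpace.norm_eq]
  refine Real.sqrt_le_sqrt ?_
  calc ∑ a, ‖(x + latticeVec fun a => -⌊x a⌋) a‖ ^ 2 ≤ ∑ _a : Fin N, (1 : ℝ) := by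
        refine Finset.sum_le_sum fun a _ => ?_
        have : (x + latticeVec fun a => -⌊x a⌋) a = Int.fract (x a) := by
          simp [latticeVec, Int.fract, sub_eq_add_neg]
        rw [this, Real.norm_of_nonneg (Int.fract_nonneg _)]
        exact pow_le_one₀ (Int.fract_nonneg _) (Int.fract_lt_one _).le
    _ = N := by simp

theorem latticeVec_neg (k : Fin N → ℤ) : latticeVec (-k) = -latticeVec k := by
  ext a
  simp [latticeVec]

theorem exists_norm_sub_add_latticeVec_le (x z : Space N) :
    ∃ k : Fin N → ℤ, ‖x - (z + latticeVec k)‖ ≤ √N := by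
  obtain ⟨k, hk⟩ := exists_norm_add_latticeVec_le (x - z)
  refine ⟨-k, ?_⟩
  rwa [latticeVec_neg, show x - (z + -latticeVec k) = x - z + latticeVec k by abel]

theorem IsPeriodic.exists_mem_ball {α : Type*} {u : Space N → α} (hu : IsPeriodic u)
    (x : Space N) : ∃ y ∈ Metric.closedBall (0 : Space N) √N, u y = u x := by
  obtain ⟨k, hk⟩ := exists_norm_add_latticeVec_le x
  exact ⟨_, mem_closedBall_zero_iff.2 hk, hu x k⟩

theorem IsPeriodic.exists_isMax_of_upperSemicontinuous {u : Space N → ℝ} (hu : IsPeriodic u)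
    (hc : UpperSemicontinuous u) : ∃ x₀, ∀ x, u x ≤ u x₀ := by
  obtain ⟨x₀, -, h⟩ := (hc.upperSemicontinuousOn _).exists_isMaxOn
    ⟨0, Metric.mem_closedBall_self (Real.sqrt_nonneg _)⟩
    (isCompact_closedBall (0 : Space N) √N)
  refine ⟨x₀, fun x => ?_⟩
  obtain ⟨y, hy, hxy⟩ := hu.exists_mem_ball x
  rw [← hxy]
  exact h hy

theorem IsPeriodic.exists_abs_le {u : Space N → ℝ} (hu : IsPeriodic u)
    (hc : Continuous u) : ∃ C, 0 ≤ C ∧ ∀ x, |u x| ≤ C := by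
  have hp : IsPeriodic fun x => |u x| := fun x k => by simp only [hu x k]
  obtain ⟨x₀, h⟩ := hp.exists_isMax_of_upperSemicontinuous hc.abs.upperSemicontinuous
  exact ⟨_, abs_nonneg _, h⟩

theorem exists_forall_le_of_fin {P : Fin m → ℝ → Prop}
    (hmono : ∀ i K K', K ≤ K' → P i K → P i K') (h : ∀ i, ∃ K, 0 ≤ K ∧ P i K) :
    ∃ K, 0 ≤ K ∧ ∀ i, P i K := by
  choose k hk0 hk using h
  exact ⟨∑ i, k i, Finset.sum_nonneg fun i _ => hk0 i, fun i =>
    hmono i _ _ (Finset.single_le_sum (fun j _ => hk0 j) (Finset.mem_univ i)) (hk i)⟩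

theorem exists_abs_le_of_fin {u : Fin m → Space N → ℝ} (hu : ∀ i, IsPeriodic (u i))
    (hc : ∀ i, Continuous (u i)) : ∃ C, 0 ≤ C ∧ ∀ i x, |u i x| ≤ C :=
  exists_forall_le_of_fin (P := fun i C => ∀ x, |u i x| ≤ C)
    (fun _ _ _ h h' x => (h' x).trans h) fun i => (hu i).exists_abs_le (hc i)

/-- Coercivity is uniform on the torus. -/
theorem IsEikonalFamily.exists_norm_le {F : Fin m → Space N → Space N → ℝ}
    {f : Fin m → Space N → ℝ} (hF : IsEikonalFamily F f) (C : ℝ) :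
    ∃ K, 0 ≤ K ∧ ∀ i x p, F i x p ≤ C → ‖p‖ ≤ K := by
  refine exists_forall_le_of_fin (P := fun i K => ∀ x p, F i x p ≤ C → ‖p‖ ≤ K)
    (fun _ _ _ h h' x p hp => (h' x p hp).trans h) fun i => ?_
  have hloc : ∀ x₀, ∃ K, 0 ≤ K ∧ ∀ᶠ x in 𝓝 x₀, ∀ p, F i x p ≤ C → ‖p‖ ≤ K := by
    intro x₀
    have h1 : ∀ᶠ p in cocompact (Space N), 1 < F i x₀ p := (hF.coercive i x₀).eventually_gt_atTop 1
    rw [Metric.cobounded_eq_cocompact.symm, ← comap_norm_atTop, eventually_comap] at h1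
    obtain ⟨R, hR0, hR⟩ := ((eventually_gt_atTop 0).and h1).exists
    have hev : ∀ᶠ x in 𝓝 x₀, ∀ q ∈ Metric.sphere (0 : Space N) R, 1 < F i x q := by
      refine (isCompact_sphere _ _).eventually_forall_of_forall_eventually fun q hq => ?_
      exact (hF.continuous_F i).continuousAt.eventually_const_lt
        (hR q (mem_sphere_zero_iff_norm.1 hq))
    refine ⟨max R (R * C), le_max_of_le_left hR0.le, ?_⟩
    filter_upwards [hev] with x hx p hp
    by_contra! hlt
    rw [max_lt_iff] at hlt
    have hp0 : 0 < ‖p‖ := hR0.trans hlt.1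
    -- Convexity and `F i x 0 = 0` make `F i x` grow at least linearly along rays beyond the sphere
    -- of radius `R`, where it exceeds `1`.
    have hq := hx ((R / ‖p‖) • p) (by
      rw [mem_sphere_zero_iff_norm, norm_smul, Real.norm_of_nonneg (by positivity)]
      field_simp)
    have ha : 0 ≤ R / ‖p‖ := by positivity
    have hb : 0 ≤ 1 - R / ‖p‖ := by rw [sub_nonneg, div_le_one hp0]; exact hlt.1.le
    have hcv := (hF.convex i x).2 (mem_univ p) (mem_univ 0) ha hb (by ring)
    simp only [smul_zero, add_zero, hF.F_zero, smul_eq_mul, mul_zero] at hcv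
    have h2 : R / ‖p‖ * F i x p ≤ R / ‖p‖ * C := mul_le_mul_of_nonneg_left hp (by positivity)
    have h3 : R / ‖p‖ * C < 1 := by
      rw [div_mul_eq_mul_div, div_lt_one hp0]
      exact hlt.2
    linarith
  choose k hk0 hk using hloc
  obtain ⟨t, -, ht⟩ := (isCompact_closedBall (0 : Space N) √N).elim_nhds_subcover
    (fun x₀ => {x | ∀ p, F i x p ≤ C → ‖p‖ ≤ k x₀}) fun x₀ _ => hk x₀
  refine ⟨∑ z ∈ t, k z, Finset.sum_nonneg fun z _ => hk0 z, fun x p hp => ?_⟩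
  obtain ⟨l, hl⟩ := exists_norm_add_latticeVec_le x
  have := ht (mem_closedBall_zero_iff.2 hl)
  simp only [mem_iUnion] at this
  obtain ⟨z, hz, hz'⟩ := this
  exact (hz' p (((hF.periodic_F i p) x l).le.trans hp)).trans
    (Finset.single_le_sum (fun z _ => hk0 z) hz)

end Periodic

/-! ### The cokernel field and oscillation bounds for the coupling. -/

section Coupling

variable {N m : ℕ} {D : Space N → Matrix (Fin m) (Fin m) ℝ}

theorem IsCouplingMatrix.exists_isPositiveCokernel (hm : 0 < m) (hD : IsCouplingMatrix D)
    (hirr : ∀ x, IsIrreducibleMatrix (D x)) (hrow : ∀ x i, ∑ j, D x i j = 0) :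
    ∃ Λ : Space N → Fin m → ℝ, IsPositiveCokernel D Λ := by
  refine ⟨fun x j => |(D x).adjugate j j|, ?_, fun x k => by simp only [hD.periodic x k],
    fun x j => abs_pos.2 (adjugate_diag_ne_zero (hD.offDiag_nonpos x) (hrow x) (hirr x) j),
    fun x => abs_adjugate_diag_mulVec hm (hD.offDiag_nonpos x) (hrow x) (hirr x)⟩
  have hc : Continuous D := continuous_matrix hD.continuous
  exact continuous_pi fun j => (hc.matrix_adjugate.matrix_elem j j).abs

theorem IsCouplingMatrix.exists_abs_le (hD : IsCouplingMatrix D) :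
    ∃ C, 0 ≤ C ∧ ∀ i j x, |D x i j| ≤ C := by
  refine exists_forall_le_of_fin (P := fun i C => ∀ j x, |D x i j| ≤ C)
    (fun _ _ _ h h' j x => (h' j x).trans h) fun i => ?_
  exact exists_abs_le_of_fin (fun j x k => by simp only [hD.periodic x k]) fun j =>
    hD.continuous i j

/-- Harnack-type inequality: an upper bound on `D v` controls the oscillation of `v`. -/
theorem IsCouplingMatrix.exists_sub_le (hD : IsCouplingMatrix D)
    (hirr : ∀ x, IsIrreducibleMatrix (D x)) (hrow : ∀ x i, ∑ j, D x i j = 0) :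
    ∃ B, 0 ≤ B ∧ ∀ C, 0 ≤ C → ∀ x (v : Fin m → ℝ), (∀ i, ∑ j, D x i j * v j ≤ C) →
      ∀ i j, v i - v j ≤ B * C := by
  have h1 : ∀ i₀ j₀ : Fin m, ∃ B, 0 ≤ B ∧ ∀ C, 0 ≤ C → ∀ x (v : Fin m → ℝ),
      (∀ i, v i ≤ v i₀) → (∀ i, v j₀ ≤ v i) → (∀ i, ∑ j, D x i j * v j ≤ C) →
        v i₀ - v j₀ ≤ B * C := by
    intro i₀ j₀
    set S : Set (Fin m → ℝ) := Icc 0 1 ∩ {v | v i₀ = 1 ∧ v j₀ = 0} with hS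
    have hScpt : IsCompact S := isCompact_Icc.inter_right
      ((isClosed_eq (continuous_apply i₀) continuous_const).inter
        (isClosed_eq (continuous_apply j₀) continuous_const))
    -- `Ψ` measures the positive part of `D v`. By the maximum principle it is positive on vectors
    -- normalised to have oscillation one, hence bounded below there by compactness; scaling gives
    -- the estimate.
    set Ψ : Space N × (Fin m → ℝ) → ℝ := fun z => ∑ i, max 0 (∑ j, D z.1 i j * z.2 j) with hΨ
    have hΨc : Continuous Ψ := by
      refine continuous_finsetSum _ fun i _ => continuous_const.max ?_
      refine continuous_finsetSum _ fun j _ => ?_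
      exact ((hD.continuous i j).comp continuous_fst).mul
        ((continuous_apply j).comp continuous_snd)
    have hpos : ∀ z ∈ Metric.closedBall (0 : Space N) √N ×ˢ S, 0 < Ψ z := by
      rintro ⟨x, v⟩ ⟨-, hv, hv1, hv0⟩
      by_contra! hle
      have h0 : ∀ i ∈ Finset.univ, 0 ≤ max 0 (∑ j, D x i j * v j) := fun i _ => le_max_left _ _
      have h2 := (Finset.sum_eq_zero_iff_of_nonneg h0).1
        (le_antisymm hle (Finset.sum_nonneg h0))
      have h3 := eq_of_sum_nonpos (hD.offDiag_nonpos x) (hrow x) (hirr x) (w := v)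
        (fun i => (le_max_right _ _).trans (h2 i (Finset.mem_univ i)).le) i₀ j₀
      exact one_ne_zero (hv1.symm.trans (h3.trans hv0))
    obtain ⟨c, hc0, hc⟩ :=
      ((isCompact_closedBall (0 : Space N) √N).prod hScpt).exists_forall_le' hΨc.continuousOn hpos
    refine ⟨m / c, by positivity, fun C hC x v hmax hmin hv => ?_⟩
    rcases (sub_nonneg.2 (hmax j₀)).eq_or_lt with h0 | h0
    · rw [← h0]; positivity
    set δ := v i₀ - v j₀ with hδ
    obtain ⟨y, hy, hyx⟩ := hD.periodic.exists_mem_ball x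
    have hmem : (fun i => (v i - v j₀) / δ) ∈ S := by
      refine ⟨⟨fun i => ?_, fun i => ?_⟩, ?_, ?_⟩
      · exact div_nonneg (sub_nonneg.2 (hmin i)) h0.le
      · show (v i - v j₀) / δ ≤ 1
        rw [div_le_one h0]
        linarith [hmax i]
      · exact div_self h0.ne'
      · simp
    have h2 := hc (y, _) ⟨hy, hmem⟩
    have h3 : Ψ (y, fun i => (v i - v j₀) / δ) ≤ ∑ _i : Fin m, C / δ := by
      refine Finset.sum_le_sum fun i _ => max_le (by positivity) ?_
      rw [hyx]
      have : ∑ j, D x i j * ((v j - v j₀) / δ) = (∑ j, D x i j * v j) / δ := by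
        simp only [mul_div_assoc', mul_sub, sub_div, Finset.sum_sub_distrib, ← Finset.sum_div,
          ← Finset.sum_mul, hrow x i]
        simp
      simp only [this]
      exact div_le_div_of_nonneg_right (hv i) h0.le
    simp only [Finset.sum_const, Finset.card_univ, Fintype.card_fin, nsmul_eq_mul] at h3
    have h4 : c ≤ m * (C / δ) := h2.trans h3
    rw [div_mul_eq_mul_div, le_div_iff₀ hc0]
    rw [← mul_div_assoc, le_div_iff₀ h0] at h4
    linarith
  obtain ⟨B, hB0, hB⟩ := exists_forall_le_of_fin (m := m)
    (P := fun i₀ B => ∀ j₀ C, 0 ≤ C → ∀ x (v : Fin m → ℝ), (∀ i, v i ≤ v i₀) →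
      (∀ i, v j₀ ≤ v i) → (∀ i, ∑ j, D x i j * v j ≤ C) → v i₀ - v j₀ ≤ B * C)
    (fun _ _ _ h h' j₀ C hC x v a b c => (h' j₀ C hC x v a b c).trans
      (mul_le_mul_of_nonneg_right h hC)) fun i₀ =>
    exists_forall_le_of_fin (m := m)
      (P := fun j₀ B => ∀ C, 0 ≤ C → ∀ x (v : Fin m → ℝ), (∀ i, v i ≤ v i₀) →
        (∀ i, v j₀ ≤ v i) → (∀ i, ∑ j, D x i j * v j ≤ C) → v i₀ - v j₀ ≤ B * C)
      (fun _ _ _ h h' C hC x v a b c => (h' C hC x v a b c).trans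
        (mul_le_mul_of_nonneg_right h hC)) fun j₀ => h1 i₀ j₀
  refine ⟨B, hB0, fun C hC x v hv i j => ?_⟩
  have : Nonempty (Fin m) := ⟨i⟩
  obtain ⟨i₀, hi₀⟩ := Finite.exists_max v
  obtain ⟨j₀, hj₀⟩ := Finite.exists_min v
  have := hB i₀ j₀ C hC x v hi₀ hj₀ hv
  linarith [hi₀ i, hj₀ j]

end Coupling

/-! ### Perron's method for the system. -/

section Perron

variable {N m : ℕ} {D : Space N → Matrix (Fin m) (Fin m) ℝ} {F : Fin m → Space N → Space N → ℝ}
  {f : Fin m → Space N → ℝ} {u v : Space N → Fin m → ℝ}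

/-- The right-hand side of the `i`-th equation, written as `F_i(x, Du_i) = f_i - (D u)_i`. -/
def residual (D : Space N → Matrix (Fin m) (Fin m) ℝ) (f : Fin m → Space N → ℝ)
    (u : Space N → Fin m → ℝ) (i : Fin m) (x : Space N) : ℝ :=
  f i x - ∑ j, D x i j * u x j

theorem isSubsolution_iff : IsSubsolution (fun i x p => F i x p - f i x) D u ↔
    IsPeriodic u ∧ (∀ i, UpperSemicontinuous fun x => u x i) ∧
      ∀ i, ViscSub (F i) (residual D f u i) (fun x => u x i) := by
  refine and_congr_right fun _ => and_congr_right fun _ => ?_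
  constructor
  · intro h i φ x hφ hx
    have := h φ i x hφ hx
    simp only [residual]
    linarith
  · intro h φ i x hφ hx
    have := h i φ x hφ hx
    simp only [residual] at this
    linarith

theorem isSupersolution_iff : IsSupersolution (fun i x p => F i x p - f i x) D u ↔
    IsPeriodic u ∧ (∀ i, LowerSemicontinuous fun x => u x i) ∧
      ∀ i, ViscSuper (F i) (residual D f u i) (fun x => u x i) := by
  refine and_congr_right fun _ => and_congr_right fun _ => ?_
  constructor
  · intro h i φ x hφ hx
    have := h φ i x hφ hx
    simp only [residual]
    linarith
  · intro h φ i x hφ hx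
    have := h i φ x hφ hx
    simp only [residual] at this
    linarith

theorem IsCouplingMatrix.continuous_residual (hD : IsCouplingMatrix D) (hF : IsEikonalFamily F f)
    (hu : Continuous u) (i : Fin m) : Continuous (residual D f u i) :=
  (hF.continuous_f i).sub (continuous_finsetSum _ fun j _ =>
    (hD.continuous i j).mul ((continuous_apply j).comp hu))

theorem residual_translate (hD : IsCouplingMatrix D) (hF : IsEikonalFamily F f)
    (k : Fin N → ℤ) (i : Fin m) (x : Space N) :
    residual D f (fun y => u (y + latticeVec k)) i x = residual D f u i (x + latticeVec k) := by
  simp only [residual, hD.periodic x k, hF.periodic_f i x k]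

/-- Raising the components other than `i` can only raise the `i`-th residual. The diagonal
contribution is the extra term allowed by `ViscSub.iSup`. -/
theorem residual_le_of_sub_nonneg (hD : IsCouplingMatrix D) {x : Space N}
    (hvu : ∀ j, v x j ≤ u x j) (i : Fin m) :
    residual D f v i x ≤ residual D f u i x + D x i i * (u x i - v x i) := by
  have h : ∑ j, D x i j * (u x j - v x j) ≤ D x i i * (u x i - v x i) := by
    rw [← Finset.add_sum_erase _ _ (Finset.mem_univ i)]
    have : ∑ j ∈ Finset.univ.erase i, D x i j * (u x j - v x j) ≤ 0 :=
      Finset.sum_nonpos fun j hj => mul_nonpos_of_nonpos_of_nonneg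
        (hD.offDiag_nonpos x i j (Finset.ne_of_mem_erase hj).symm) (sub_nonneg.2 (hvu j))
    linarith
  simp only [mul_sub, Finset.sum_sub_distrib] at h
  simp only [residual]
  linarith

theorem residual_update (β : Space N → ℝ) (i j : Fin m) (x : Space N) :
    residual D f (fun y => Function.update (u y) i (β y)) j x
      = residual D f u j x - D x j i * (β x - u x i) := by
  have : ∑ l, D x j l * (Function.update (u x) i (β x) l - u x l) = D x j i * (β x - u x i) := by
    rw [Finset.sum_eq_single i]
    · simp
    · intro l _ hl
      simp [Function.update_of_ne hl]
    · simp
  simp only [mul_sub, Finset.sum_sub_distrib] at this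
  simp only [residual]
  linarith

/-- The class of subsolutions, with prescribed values on `Z`, used in Perron's method. -/
structure PerronClass (D : Space N → Matrix (Fin m) (Fin m) ℝ)
    (F : Fin m → Space N → Space N → ℝ) (f : Fin m → Space N → ℝ) (Z : Set (Space N))
    (v₀ : Space N → Fin m → ℝ) (M : ℝ) (v : Space N → Fin m → ℝ) : Prop where
  continuous : Continuous v
  sub : ∀ i, ViscSub (F i) (residual D f v i) fun x => v x i
  lower : ∀ x i, v₀ x i ≤ v x i
  upper : ∀ x i, v x i ≤ M
  eqOn : ∀ x ∈ Z, v x = v₀ x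

variable {Z : Set (Space N)} {v₀ : Space N → Fin m → ℝ} {M K : ℝ}

/-- Members of the class need not be periodic, so a local bump stays admissible; invariance under
lattice translations is what makes the envelope periodic. -/
theorem PerronClass.translate (hD : IsCouplingMatrix D) (hF : IsEikonalFamily F f)
    (hZ : ∀ x ∈ Z, ∀ k : Fin N → ℤ, x + latticeVec k ∈ Z) (hv₀ : IsPeriodic v₀)
    (hv : PerronClass D F f Z v₀ M v) (k : Fin N → ℤ) :
    PerronClass D F f Z v₀ M fun x => v (x + latticeVec k) where
  continuous := hv.continuous.comp (by fun_prop)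
  sub i := by
    have := (hv.sub i).translate (latticeVec k) (fun x p => hF.periodic_F i p x k)
    simpa only [residual_translate hD hF k i] using
      this.mono (fun x => (residual_translate hD hF k i x).ge)
  lower x i := by rw [← hv₀ x k]; exact hv.lower _ i
  upper x i := hv.upper _ i
  eqOn x hx := by rw [← hv₀ x k]; exact hv.eqOn _ (hZ x hx k)

/-- The upper envelope of the Perron class. -/
def perronSup (D : Space N → Matrix (Fin m) (Fin m) ℝ)
    (F : Fin m → Space N → Space N → ℝ) (f : Fin m → Space N → ℝ) (Z : Set (Space N))
    (v₀ : Space N → Fin m → ℝ) (M : ℝ) (x : Space N) (i : Fin m) : ℝ :=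
  ⨆ v : {v // PerronClass D F f Z v₀ M v}, v.1 x i

theorem PerronClass.le_perronSup (hv : PerronClass D F f Z v₀ M v) (x : Space N) (i : Fin m) :
    v x i ≤ perronSup D F f Z v₀ M x i :=
  le_ciSup (f := fun v : {v // PerronClass D F f Z v₀ M v} => v.1 x i)
    ⟨M, by rintro _ ⟨w, rfl⟩; exact w.2.upper x i⟩ ⟨v, hv⟩

theorem perronSup_isPeriodic (hD : IsCouplingMatrix D) (hF : IsEikonalFamily F f)
    (hZ : ∀ x ∈ Z, ∀ k : Fin N → ℤ, x + latticeVec k ∈ Z)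
    (h₀ : PerronClass D F f Z v₀ M v₀) (hv₀ : IsPeriodic v₀) :
    IsPeriodic (perronSup D F f Z v₀ M) := by
  have : Nonempty {v // PerronClass D F f Z v₀ M v} := ⟨⟨v₀, h₀⟩⟩
  have hle : ∀ x k i, perronSup D F f Z v₀ M (x + latticeVec k) i
      ≤ perronSup D F f Z v₀ M x i := fun x k i =>
    ciSup_le fun w => (w.2.translate hD hF hZ hv₀ k).le_perronSup x i
  intro x k
  ext i
  refine le_antisymm (hle x k i) ?_
  have := hle (x + latticeVec k) (-k) i
  rwa [latticeVec_neg, add_neg_cancel_right] at this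

theorem perronSup_mem (hD : IsCouplingMatrix D) (hF : IsEikonalFamily F f)
    (h₀ : PerronClass D F f Z v₀ M v₀) (hK0 : 0 ≤ K)
    (hK : ∀ v, PerronClass D F f Z v₀ M v → ∀ i, LipBound K fun x => v x i) :
    PerronClass D F f Z v₀ M (perronSup D F f Z v₀ M) := by
  have : Nonempty {v // PerronClass D F f Z v₀ M v} := ⟨⟨v₀, h₀⟩⟩
  set ι := {v // PerronClass D F f Z v₀ M v}
  set u := perronSup D F f Z v₀ M with hu
  have hub : ∀ i (w : ι) x, w.1 x i ≤ u x i := fun i w x => w.2.le_perronSup x i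
  have hlub : ∀ i x, ∀ ε > 0, ∃ w : ι, u x i - ε < w.1 x i := fun i x ε hε =>
    exists_lt_of_lt_ciSup (sub_lt_self _ hε)
  have hL : ∀ i, LipBound K fun x => u x i := fun i =>
    LipBound.iSup (v := fun w : ι => fun x => w.1 x i) (fun w => hK w.1 w.2 i) (hub i) (hlub i)
  have huc : Continuous u := continuous_pi fun i => (hL i).continuous
  refine ⟨huc, fun i => ?_, fun x i => h₀.le_perronSup x i, fun x i =>
    ciSup_le fun w => w.2.upper x i, fun x hx => ?_⟩
  · refine ViscSub.iSup (v := fun w : ι => fun x => w.1 x i) (d := fun x => D x i i)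
      (hF.continuous_F i) (hD.continuous_residual hF huc i) (hD.continuous i i) hK0
      (fun w => hK w.1 w.2 i) (fun w => ?_) (hub i) (hlub i)
    exact (w.2.sub i).mono fun x => residual_le_of_sub_nonneg hD (fun j => hub j w x) i
  · ext i
    refine le_antisymm (ciSup_le fun w => ?_) (h₀.le_perronSup x i)
    rw [w.2.eqOn x hx]

/-- If the test failed at `x₀`, raising only the component `i` near `x₀` to `max (u_i, ψ + δ)` would
stay in the class and exceed the envelope. Room for this requires being off `Z` and below `M`. -/
theorem perronSup_super (hD : IsCouplingMatrix D) (hF : IsEikonalFamily F f) (hZc : IsClosed Z)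
    (hu : PerronClass D F f Z v₀ M (perronSup D F f Z v₀ M)) {φ : Space N → ℝ} {i : Fin m}
    {x₀ : Space N} (hφ : ContDiff ℝ 1 φ)
    (hmin : IsLocalMin (fun y => perronSup D F f Z v₀ M y i - φ y) x₀) (hx₀ : x₀ ∉ Z)
    (hM : perronSup D F f Z v₀ M x₀ i < M) :
    residual D f (perronSup D F f Z v₀ M) i x₀ ≤ F i x₀ (gradient φ x₀) := by
  by_contra! hlt
  set u := perronSup D F f Z v₀ M with hudef
  have huc := hu.continuous
  have huic : Continuous fun y => u y i := (continuous_apply i).comp huc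
  -- Subtracting the square makes the contact from below strict, so that `ψ + δ` drops under `u i`
  -- before the edge of the ball.
  set ψ : Space N → ℝ := fun y => (φ y + (u x₀ i - φ x₀)) + (-1) * ‖y - x₀‖ ^ 2 with hψ
  set g : Space N → Space N := fun y => (gradient φ y + 0) + (2 * (-1 : ℝ)) • (y - x₀) with hg
  have hψsm : ContDiff ℝ 1 ψ := (hφ.add contDiff_const).add (contDiff_norm_sub_sq (-1) x₀)
  have hgrad : ∀ y, HasGradientAt ψ (g y) y := fun y =>
    hasGradientAt_add (hasGradientAt_add (contDiff_hasGradientAt hφ y) (hasGradientAt_const y _))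
      (hasGradientAt_norm_sq (-1) x₀ y)
  have hgc : Continuous g := by
    have := contDiff_continuous_gradient hφ
    fun_prop
  have hψc := hψsm.continuous
  have hψ₀ : ψ x₀ = u x₀ i := by simp [hψ]
  have hg₀ : g x₀ = gradient φ x₀ := by simp [hg]
  have hev : ∀ᶠ z : Space N × ℝ in 𝓝 (x₀, 0),
      (F i z.1 (g z.1) < residual D f u i z.1 - D z.1 i i * (ψ z.1 + z.2 - u z.1 i) ∧
        ψ z.1 + z.2 < M) ∧ z.1 ∉ Z ∧ u x₀ i - φ x₀ ≤ u z.1 i - φ z.1 := by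
    have c1 : Continuous fun z : Space N × ℝ => F i z.1 (g z.1) :=
      (hF.continuous_F i).comp (by fun_prop : Continuous fun z : Space N × ℝ => (z.1, g z.1))
    have c2 : Continuous fun z : Space N × ℝ =>
        residual D f u i z.1 - D z.1 i i * (ψ z.1 + z.2 - u z.1 i) := by
      have a1 := hD.continuous_residual hF huc i
      have a2 := hD.continuous i i
      fun_prop
    have c3 : Continuous fun z : Space N × ℝ => ψ z.1 + z.2 := by fun_prop
    have t : Tendsto (Prod.fst : Space N × ℝ → Space N) (𝓝 (x₀, 0)) (𝓝 x₀) :=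
      continuous_fst.tendsto (x₀, (0 : ℝ))
    refine ((c1.continuousAt.eventually_lt c2.continuousAt ?_).and
      (c3.continuousAt.eventually_lt_const ?_)).and
      ((t.eventually (hZc.isOpen_compl.mem_nhds hx₀)).and (t.eventually hmin))
    · simp only [hψ₀, hg₀]
      simpa using hlt
    · simpa [hψ₀] using hM
  obtain ⟨ε, hε, hball⟩ := Metric.eventually_nhds_iff.1 hev
  obtain ⟨δ, hδ0, hδε, hδε'⟩ : ∃ δ > 0, δ < ε ∧ δ < (ε / 2) ^ 2 := by
    obtain ⟨δ, h1, h2⟩ := exists_between (show 0 < min ε ((ε / 2) ^ 2) by positivity)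
    exact ⟨δ, h1, (lt_min_iff.1 h2).1, (lt_min_iff.1 h2).2⟩
  have hloc : ∀ y, ‖y - x₀‖ < ε →
      (F i y (g y) < residual D f u i y - D y i i * (ψ y + δ - u y i) ∧ ψ y + δ < M) ∧
        y ∉ Z ∧ u x₀ i - φ x₀ ≤ u y i - φ y := by
    intro y hy
    refine hball (y := (y, δ)) ?_
    simp only [Prod.dist_eq, max_lt_iff]
    simp only [dist_eq_norm, sub_zero, Real.norm_of_nonneg hδ0.le]
    exact ⟨hy, hδε⟩
  have hfar : ∀ y, ‖y - x₀‖ < ε → ε / 2 ≤ ‖y - x₀‖ → ψ y + δ < u y i := by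
    intro y h1 h2
    have h3 := (hloc y h1).2.2
    have h4 : (ε / 2) ^ 2 ≤ ‖y - x₀‖ ^ 2 := pow_le_pow_left₀ (by positivity) h2 2
    simp only [hψ]
    linarith
  set β : Space N → ℝ := fun y => if ‖y - x₀‖ < ε then max (u y i) (ψ y + δ) else u y i with hβ
  have hβin : ∀ y, ‖y - x₀‖ < ε → β y = max (u y i) (ψ y + δ) := fun y hy => if_pos hy
  have hβout : ∀ y, ε / 2 < ‖y - x₀‖ → β y = u y i := by
    intro y hy
    by_cases h : ‖y - x₀‖ < ε
    · rw [hβin y h]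
      exact max_eq_left (hfar y h hy.le).le
    · exact if_neg h
  have hβu : ∀ y, u y i ≤ β y := by
    intro y
    by_cases h : ‖y - x₀‖ < ε
    · rw [hβin y h]
      exact le_max_left _ _
    · exact (if_neg h).ge
  have hβlt : ∀ y, u y i < β y → ‖y - x₀‖ < ε ∧ β y = ψ y + δ := by
    intro y hy
    have h : ‖y - x₀‖ < ε := by
      by_contra h
      rw [hβout y (by linarith)] at hy
      exact lt_irrefl _ hy
    refine ⟨h, ?_⟩
    rw [hβin y h] at hy ⊢
    exact max_eq_right (by
      rcases lt_max_iff.1 hy with h | h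
      · exact absurd h (lt_irrefl _)
      · exact h.le)
  have hnc : Continuous fun y : Space N => ‖y - x₀‖ := by fun_prop
  have hβc : Continuous β := by
    rw [continuous_iff_continuousAt]
    intro y
    by_cases h : ‖y - x₀‖ < ε
    · have : (fun z => max (u z i) (ψ z + δ)) =ᶠ[𝓝 y] β := by
        filter_upwards [hnc.continuousAt.eventually_lt_const h] with z hz
        exact (hβin z hz).symm
      exact (huic.max (hψc.add continuous_const)).continuousAt.congr this
    · have : (fun z => u z i) =ᶠ[𝓝 y] β := by
        filter_upwards [hnc.continuousAt.eventually_const_lt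
          (show ε / 2 < ‖y - x₀‖ by linarith)] with z hz
        exact (hβout z hz).symm
      exact huic.continuousAt.congr this
  have hmem : PerronClass D F f Z v₀ M fun y => Function.update (u y) i (β y) := by
    refine ⟨huc.update i hβc, fun j => ?_, fun y j => ?_, fun y j => ?_, fun y hy => ?_⟩
    · intro η y hη hmax
      rw [residual_update]
      by_cases hj : j = i
      · subst hj
        simp only [Function.update_self] at hmax
        rcases (hβu y).eq_or_lt with heq | hgt
        · rw [← heq, sub_self, mul_zero, sub_zero]
          refine hu.sub j η y hη ?_
          filter_upwards [hmax] with z hz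
          rw [← heq] at hz
          exact (sub_le_sub_right (hβu z) _).trans hz
        · obtain ⟨hy, hyβ⟩ := hβlt y hgt
          -- Where the bump is active, `ψ + δ` lies below the modified component near `y` and equals
          -- it at `y`, so `ψ - η` has a maximum and the gradients agree.
          have hmax' : IsLocalMax (fun z => ψ z + - η z) y := by
            filter_upwards [hmax, hnc.continuousAt.eventually_lt_const hy] with z hz hz'
            have : ψ z + δ ≤ β z := by rw [hβin z hz']; exact le_max_right _ _
            rw [hyβ] at hz
            linarith
          have hgr := hasGradientAt_add (hgrad y) (hasGradientAt_neg (contDiff_hasGradientAt hη y))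
          have h0 := hmax'.hasFDerivAt_eq_zero (hasGradientAt_iff_hasFDerivAt.1 hgr)
          have h1 : g y = gradient η y := by
            rw [LinearIsometryEquiv.map_eq_zero_iff] at h0
            rwa [← sub_eq_add_neg, sub_eq_zero] at h0
          rw [← h1, hyβ]
          exact (hloc y hy).1.1.le
      -- For `j ≠ i` the raised component enters with coefficient `D y j i ≤ 0` and only relaxes the
      -- inequality.
      · simp only [Function.update_of_ne hj] at hmax
        have h1 := hu.sub j η y hη hmax
        have h2 := mul_nonpos_of_nonpos_of_nonneg (hD.offDiag_nonpos y j i hj)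
          (sub_nonneg.2 (hβu y))
        linarith
    · by_cases hj : j = i
      · subst hj
        rw [Function.update_self]
        exact (hu.lower y j).trans (hβu y)
      · rw [Function.update_of_ne hj]
        exact hu.lower y j
    · by_cases hj : j = i
      · subst hj
        rw [Function.update_self]
        rcases (hβu y).eq_or_lt with heq | hgt
        · rw [← heq]; exact hu.upper y j
        · obtain ⟨hy, hyβ⟩ := hβlt y hgt
          rw [hyβ]
          exact (hloc y hy).1.2.le
      · rw [Function.update_of_ne hj]
        exact hu.upper y j
    · have : β y = u y i := by
        rcases (hβu y).eq_or_lt with heq | hgt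
        · exact heq.symm
        · exact absurd hy (hloc y (hβlt y hgt).1).2.1
      rw [this, Function.update_eq_self]
      exact hu.eqOn y hy
  have h1 := hmem.le_perronSup x₀ i
  rw [Function.update_self, hβin x₀ (by simpa using hε), hψ₀] at h1
  have := le_max_right (u x₀ i) (u x₀ i + δ)
  linarith

end Perron

/-! ### Scaled subsolutions and comparison at a maximum. -/

section System

variable {N m : ℕ} {D : Space N → Matrix (Fin m) (Fin m) ℝ} {F : Fin m → Space N → Space N → ℝ}
  {f : Fin m → Space N → ℝ} {u v : Space N → Fin m → ℝ}

theorem viscSub_const {G : Space N → Space N → ℝ} {A : Space N → ℝ} (h : ∀ x, G x 0 ≤ A x)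
    (c : ℝ) : ViscSub G A fun _ => c := by
  intro φ x hφ hx
  have hmin : IsLocalMin φ x := by
    filter_upwards [hx] with y hy
    linarith
  have h0 := hmin.hasFDerivAt_eq_zero
    (hasGradientAt_iff_hasFDerivAt.1 (contDiff_hasGradientAt hφ x))
  rw [LinearIsometryEquiv.map_eq_zero_iff] at h0
  rw [h0]
  exact h x

theorem gradient_const_mul {φ : Space N → ℝ} (hφ : ContDiff ℝ 1 φ) (c : ℝ) (x : Space N) :
    gradient (fun y => c * φ y) x = c • gradient φ x := by
  refine HasGradientAt.gradient ?_
  rw [hasGradientAt_iff_hasFDerivAt]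
  have := (hasGradientAt_iff_hasFDerivAt.1 (contDiff_hasGradientAt hφ x)).const_mul c
  simpa using this

/-- Convexity with `G x 0 = 0` gives `G x (c p) ≤ c G x p`. For `c < 1` this yields strictness
wherever `f` is positive. -/
theorem ViscSub.const_mul {G : Space N → Space N → ℝ} {A w : Space N → ℝ} (h : ViscSub G A w)
    (hconv : ∀ x, ConvexOn ℝ univ (G x)) (h0 : ∀ x, G x 0 = 0) {c : ℝ} (hc0 : 0 < c)
    (hc1 : c ≤ 1) : ViscSub G (fun x => c * A x) fun x => c * w x := by
  intro φ x hφ hx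
  have h1 := h (fun y => c⁻¹ * φ y) x (contDiff_const.mul hφ) (by
    filter_upwards [hx] with y hy
    have := mul_le_mul_of_nonneg_left hy (inv_pos.2 hc0).le
    simp only [mul_sub, inv_mul_cancel_left₀ hc0.ne'] at this
    exact this)
  rw [gradient_const_mul hφ] at h1
  have h2 := (hconv x).2 (mem_univ (c⁻¹ • gradient φ x)) (mem_univ 0) hc0.le
    (sub_nonneg.2 hc1) (by ring)
  simp only [smul_zero, add_zero, h0, smul_eq_mul, mul_zero, smul_inv_smul₀ hc0.ne'] at h2
  exact h2.trans (mul_le_mul_of_nonneg_left h1 hc0.le)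

theorem isSolution_iff : IsSolution (fun i x p => F i x p - f i x) D u ↔
    Continuous u ∧ IsPeriodic u ∧ (∀ i, ViscSub (F i) (residual D f u i) fun x => u x i) ∧
      ∀ i, ViscSuper (F i) (residual D f u i) fun x => u x i := by
  rw [IsSolution, isSubsolution_iff, isSupersolution_iff]
  constructor
  · rintro ⟨hc, ⟨hp, -, h1⟩, -, -, h2⟩
    exact ⟨hc, hp, h1, h2⟩
  · rintro ⟨hc, hp, h1, h2⟩
    have hci : ∀ i, Continuous fun x => u x i := fun i => (continuous_apply i).comp hc
    exact ⟨hc, ⟨hp, fun i => (hci i).upperSemicontinuous, h1⟩, hp,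
      fun i => (hci i).lowerSemicontinuous, h2⟩

theorem residual_isPeriodic (hD : IsCouplingMatrix D) (hF : IsEikonalFamily F f)
    (hu : IsPeriodic u) (i : Fin m) : IsPeriodic (residual D f u i) := fun x k => by
  simp only [residual, hD.periodic x k, hF.periodic_f i x k, hu x k]

theorem IsPeriodic.comp_apply (hu : IsPeriodic u) (i : Fin m) : IsPeriodic fun x => u x i :=
  fun x k => by simp only [hu x k]

theorem exists_isMax_fin {w : Space N → Fin m → ℝ} (hm : 0 < m) (hp : IsPeriodic w)
    (hc : Continuous w) : ∃ x₀ i₀, ∀ x i, w x i ≤ w x₀ i₀ := by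
  have : Nonempty (Fin m) := ⟨⟨0, hm⟩⟩
  choose z hz using fun i => (hp.comp_apply i).exists_isMax_of_upperSemicontinuous
    ((continuous_apply i).comp hc).upperSemicontinuous
  obtain ⟨i₀, hi₀⟩ := Finite.exists_max fun i => w (z i) i
  exact ⟨z i₀, i₀, fun x i => (hz i x).trans (hi₀ i)⟩

theorem IsEikonalFamily.exists_lipBound (hF : IsEikonalFamily F f) (C : ℝ) :
    ∃ K, 0 ≤ K ∧ ∀ (i : Fin m) (A v : Space N → ℝ), ViscSub (F i) A v → UpperSemicontinuous v →
      (∃ B, ∀ x, v x ≤ B) → (∀ x, A x ≤ C) → LipBound K v := by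
  obtain ⟨K, hK0, hK⟩ := hF.exists_norm_le C
  exact ⟨K, hK0, fun i A v h hc hb hA =>
    h.lipBound hc hb hK0 fun x p hp => hK i x p (hp.trans (hA x))⟩

theorem exists_lipBound_of_viscSub (hD : IsCouplingMatrix D) (hF : IsEikonalFamily F f)
    (hc : Continuous u) (hp : IsPeriodic u)
    (hu : ∀ i, ViscSub (F i) (residual D f u i) fun x => u x i) :
    ∃ K, 0 ≤ K ∧ ∀ i, LipBound K fun x => u x i := by
  obtain ⟨C, -, hC⟩ := exists_abs_le_of_fin (fun i => residual_isPeriodic hD hF hp i)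
    fun i => hD.continuous_residual hF hc i
  obtain ⟨K, hK0, hK⟩ := hF.exists_lipBound C
  refine ⟨K, hK0, fun i => ?_⟩
  have hci : Continuous fun x => u x i := (continuous_apply i).comp hc
  obtain ⟨B, -, hB⟩ := (hp.comp_apply i).exists_abs_le hci
  exact hK i _ _ (hu i) hci.upperSemicontinuous ⟨B, fun x => (le_abs_self _).trans (hB x)⟩
    fun x => (le_abs_self _).trans (hC i x)

/-- Comparison of a scaled subsolution with a supersolution at a maximum point. -/
theorem residual_le_at_max (hD : IsCouplingMatrix D) (hF : IsEikonalFamily F f)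
    (hu : IsSolution (fun i x p => F i x p - f i x) D u)
    (hv : IsSolution (fun i x p => F i x p - f i x) D v) {c : ℝ} (hc0 : 0 < c) (hc1 : c ≤ 1)
    {x₀ : Space N} {i : Fin m} (hmax : ∀ y, c * u y i - v y i ≤ c * u x₀ i - v x₀ i) :
    ∑ j, D x₀ i j * (c * u x₀ j - v x₀ j) ≤ (c - 1) * f i x₀ := by
  obtain ⟨huc, hup, hus, -⟩ := isSolution_iff.1 hu
  obtain ⟨hvc, hvp, -, hvs⟩ := isSolution_iff.1 hv
  obtain ⟨K, hK0, hK⟩ := exists_lipBound_of_viscSub hD hF huc hup hus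
  have hL : LipBound K fun x => c * u x i := by
    intro x y
    have h1 := mul_le_mul_of_nonneg_left (hK i x y) hc0.le
    have h2 : c * (K * ‖x - y‖) ≤ 1 * (K * ‖x - y‖) :=
      mul_le_mul_of_nonneg_right hc1 (by positivity)
    simp only at h1 ⊢
    linarith
  have := ((hus i).const_mul (hF.convex i) (hF.F_zero i) hc0 hc1).comparison_at_max (hvs i) hL hK0
    ((continuous_apply i).comp hvc) (hF.continuous_F i)
    (continuous_const.mul (hD.continuous_residual hF huc i)) (hD.continuous_residual hF hvc i)
    hmax
  simp only [residual] at this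
  have h2 : ∑ j, D x₀ i j * (c * u x₀ j - v x₀ j)
      = c * ∑ j, D x₀ i j * u x₀ j - ∑ j, D x₀ i j * v x₀ j := by
    rw [Finset.mul_sum, ← Finset.sum_sub_distrib]
    exact Finset.sum_congr rfl fun j _ => by ring
  rw [h2]
  linarith

/-- At a maximal index, `D w` dominates the maximum times the row sum. -/
theorem IsCouplingMatrix.rowSum_mul_le (hD : IsCouplingMatrix D) {x : Space N} {w : Fin m → ℝ}
    {i : Fin m} (hw : ∀ j, w j ≤ w i) : (∑ j, D x i j) * w i ≤ ∑ j, D x i j * w j := by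
  rw [Finset.sum_mul]
  refine Finset.sum_le_sum fun j _ => ?_
  by_cases h : i = j
  · rw [h]
  · exact mul_le_mul_of_nonpos_left (hw j) (hD.offDiag_nonpos x i j h)

end System

/-! ### Positive row sums. -/

section Classical

variable {N m : ℕ} {D : Space N → Matrix (Fin m) (Fin m) ℝ} {F : Fin m → Space N → Space N → ℝ}
  {f : Fin m → Space N → ℝ} {u v : Space N → Fin m → ℝ}

theorem solution_le_of_rowSum_pos (hm : 0 < m) (hD : IsCouplingMatrix D)
    (hF : IsEikonalFamily F f) (hpos : ∀ x i, 0 < ∑ j, D x i j)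
    (hu : IsSolution (fun i x p => F i x p - f i x) D u)
    (hv : IsSolution (fun i x p => F i x p - f i x) D v) (x : Space N) (i : Fin m) :
    u x i ≤ v x i := by
  obtain ⟨x₀, i₀, h⟩ := exists_isMax_fin (w := fun x i => u x i - v x i) hm
    (fun x k => by simp only [hu.2.1.1 x k, hv.2.1.1 x k])
    (continuous_pi fun i => ((continuous_apply i).comp hu.1).sub ((continuous_apply i).comp hv.1))
  have h1 := residual_le_at_max hD hF hu hv one_pos le_rfl (x₀ := x₀) (i := i₀) fun y => by
    simpa only [one_mul] using h y i₀
  simp only [one_mul, sub_self, zero_mul] at h1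
  have h2 := hD.rowSum_mul_le (x := x₀) (w := fun j => u x₀ j - v x₀ j) (i := i₀) fun j => h x₀ j
  have h3 : u x₀ i₀ - v x₀ i₀ ≤ 0 := by
    by_contra! h4
    have := mul_pos (hpos x₀ i₀) h4
    linarith
  linarith [h x i]

theorem exists_solution_of_rowSum_pos (hD : IsCouplingMatrix D)
    (hF : IsEikonalFamily F f) (hpos : ∀ x i, 0 < ∑ j, D x i j) :
    ∃ u : Space N → Fin m → ℝ, IsSolution (fun i x p => F i x p - f i x) D u := by
  obtain ⟨Cf, hCf0, hCf⟩ := exists_abs_le_of_fin hF.periodic_f hF.continuous_f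
  obtain ⟨CD, hCD0, hCD⟩ := hD.exists_abs_le
  have hsc : ∀ i, Continuous fun x => ∑ j, D x i j := fun i =>
    continuous_finsetSum _ fun j _ => hD.continuous i j
  have hsp : ∀ i, IsPeriodic fun x => ∑ j, D x i j := fun i x k => by simp only [hD.periodic x k]
  obtain ⟨M₁, -, hM₁⟩ := exists_abs_le_of_fin (u := fun i x => (∑ j, D x i j)⁻¹)
    (fun i x k => by simp only [hsp i x k])
    fun i => (hsc i).inv₀ fun x => (hpos x i).ne'
  -- Chosen so that `(∑ j, D x i j) * M ≥ f i x`: the constant `M` is a supersolution, and `0` is a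
  -- subsolution because `f ≥ 0`.
  set M := |M₁| * Cf with hM
  have hM0 : 0 ≤ M := by positivity
  have hfM : ∀ i x, f i x ≤ (∑ j, D x i j) * M := by
    intro i x
    have h1 := (le_abs_self _).trans ((hM₁ i x).trans (le_abs_self _))
    have h2 : 1 ≤ (∑ j, D x i j) * |M₁| := by
      rwa [inv_le_iff_one_le_mul₀ (hpos x i), mul_comm] at h1
    have h3 := mul_le_mul_of_nonneg_right h2 hCf0
    rw [one_mul] at h3
    calc f i x ≤ Cf := (le_abs_self _).trans (hCf i x)
      _ ≤ _ := h3
      _ = _ := by rw [hM]; ring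
  obtain ⟨K, hK0, hK⟩ := hF.exists_lipBound (Cf + ∑ _j : Fin m, CD * M)
  have hLip : ∀ v, PerronClass D F f ∅ (fun _ _ => 0) M v → ∀ i, LipBound K fun x => v x i := by
    intro v hv i
    refine hK i _ _ (hv.sub i) ((continuous_apply i).comp hv.continuous).upperSemicontinuous
      ⟨M, fun x => hv.upper x i⟩ fun x => ?_
    have h1 : -∑ j, D x i j * v x j ≤ ∑ _j : Fin m, CD * M := by
      rw [← Finset.sum_neg_distrib]
      refine Finset.sum_le_sum fun j _ => (neg_le_abs _).trans ?_
      rw [abs_mul, abs_of_nonneg (hv.lower x j)]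
      exact mul_le_mul (hCD i j x) (hv.upper x j) (hv.lower x j) hCD0
    have h2 := (le_abs_self _).trans (hCf i x)
    simp only [residual]
    linarith
  have h₀ : PerronClass D F f ∅ (fun _ _ => 0) M fun _ _ => 0 :=
    ⟨continuous_const, fun i => viscSub_const (fun x => by
      simpa [residual, hF.F_zero i x] using hF.f_nonneg i x) 0, fun _ _ => le_rfl,
      fun _ _ => hM0, fun _ _ => rfl⟩
  have hu := perronSup_mem hD hF h₀ hK0 hLip
  refine ⟨_, isSolution_iff.2 ⟨hu.continuous, perronSup_isPeriodic hD hF (by simp) h₀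
    (fun _ _ => rfl), hu.sub, fun i φ x hφ hx => ?_⟩⟩
  rcases (hu.upper x i).lt_or_eq with hlt | heq
  · exact perronSup_super hD hF isClosed_empty hu hφ hx (notMem_empty x) hlt
  -- Where the envelope reaches `M`, there is no room for a bump, but `D u ≥ f` holds in this
  -- component and `F ≥ 0` finishes.
  · have h1 := hD.rowSum_mul_le (x := x) (w := perronSup D F f ∅ (fun _ _ => 0) M x) (i := i)
      fun j => by rw [heq]; exact hu.upper x j
    rw [heq] at h1
    have h2 := hfM i x
    have h3 := hF.F_nonneg i x (gradient φ x)
    simp only [residual]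
    linarith

end Classical

/-! ### Zero row sums: comparison and equi-Lipschitz bounds. -/

section Degenerate

variable {N m : ℕ} {D : Space N → Matrix (Fin m) (Fin m) ℝ} {F : Fin m → Space N → Space N → ℝ}
  {f : Fin m → Space N → ℝ} {u v : Space N → Fin m → ℝ}

theorem IsEikonalFamily.eq_zero_of_mem (hF : IsEikonalFamily F f) {x : Space N}
    (hx : x ∈ zeroSet f) (i : Fin m) : f i x = 0 :=
  (Finset.sum_eq_zero_iff_of_nonneg fun i _ => hF.f_nonneg i x).1 hx i (Finset.mem_univ i)

/-- On the zero set nonnegativity of the residual reads `D u ≤ 0`, and the strong maximum principle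
applies. -/
theorem eq_of_mem_zeroSet (hD : IsCouplingMatrix D) (hirr : ∀ x, IsIrreducibleMatrix (D x))
    (hF : IsEikonalFamily F f) (hrow : ∀ x i, ∑ j, D x i j = 0) (hc : Continuous u)
    (hu : ∀ i, ViscSub (F i) (residual D f u i) fun x => u x i) {x : Space N}
    (hx : x ∈ zeroSet f) (i j : Fin m) : u x i = u x j := by
  refine eq_of_sum_nonpos (hD.offDiag_nonpos x) (hrow x) (hirr x) (fun l => ?_) i j
  have := (hu l).nonneg ((continuous_apply l).comp hc) (hD.continuous_residual hF hc l)
    (hF.F_nonneg l) x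
  simp only [residual, hF.eq_zero_of_mem hx l] at this
  linarith

/-- Comparison principle in the degenerate case, with boundary data on the zero set. -/
theorem solution_le_of_rowSum_zero (hm : 0 < m) (hD : IsCouplingMatrix D)
    (hirr : ∀ x, IsIrreducibleMatrix (D x)) (hF : IsEikonalFamily F f)
    (hrow : ∀ x i, ∑ j, D x i j = 0)
    (hu : IsSolution (fun i x p => F i x p - f i x) D u)
    (hv : IsSolution (fun i x p => F i x p - f i x) D v)
    (huv : ∀ x ∈ zeroSet f, ∀ i, u x i ≤ v x i) (x : Space N) (i : Fin m) : u x i ≤ v x i := by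
  obtain ⟨C, hC0, hC⟩ := exists_abs_le_of_fin (fun i => IsPeriodic.comp_apply hu.2.1.1 i)
    fun i => (continuous_apply i).comp hu.1
  have key : ∀ c : ℝ, 0 < c → c < 1 → c * u x i - v x i ≤ (1 - c) * C := by
    intro c hc0 hc1
    obtain ⟨x₀, i₀, h⟩ := exists_isMax_fin (w := fun x i => c * u x i - v x i) hm
      (fun x k => by simp only [hu.2.1.1 x k, hv.2.1.1 x k])
      (continuous_pi fun i => (continuous_const.mul ((continuous_apply i).comp hu.1)).sub
        ((continuous_apply i).comp hv.1))
    refine (h x i).trans ?_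
    -- All components of `c u - v` reach the maximum at `x₀`, so `D (c u - v) = 0` there, and `0 ≤
    -- (c - 1) f_i` with `c < 1` kills each `f_i`.
    have hF0 : x₀ ∈ zeroSet f := by
      have h1 : ∀ i, c * u x₀ i - v x₀ i = c * u x₀ i₀ - v x₀ i₀ →
          ∑ j, D x₀ i j * (c * u x₀ j - v x₀ j) ≤ (c - 1) * f i x₀ := fun i hi =>
        residual_le_at_max hD hF hu hv hc0 hc1.le fun y => (h y i).trans hi.ge
      have h2 := eq_max_of_sum_nonpos (hD.offDiag_nonpos x₀) (hrow x₀) (hirr x₀)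
        (w := fun i => c * u x₀ i - v x₀ i) (fun i => h x₀ i) ⟨i₀, rfl⟩ fun i hi =>
          (h1 i hi).trans (mul_nonpos_of_nonpos_of_nonneg (by linarith) (hF.f_nonneg i x₀))
      refine Finset.sum_eq_zero fun i _ => ?_
      have h3 := h1 i (h2 i)
      simp only [fun j => h2 j, ← Finset.sum_mul, hrow, zero_mul] at h3
      nlinarith [hF.f_nonneg i x₀]
    have h4 := huv x₀ hF0 i₀
    have h5 := (neg_le_abs _).trans (hC i₀ x₀)
    nlinarith
  have t1 : Tendsto (fun c : ℝ => c * u x i - v x i) (𝓝[<] 1) (𝓝 (1 * u x i - v x i)) :=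
    ((continuous_id.mul continuous_const).sub continuous_const).continuousAt.tendsto.mono_left
      nhdsWithin_le_nhds
  have t2 : Tendsto (fun c : ℝ => (1 - c) * C) (𝓝[<] 1) (𝓝 ((1 - 1) * C)) :=
    ((continuous_const.sub continuous_id).mul continuous_const).continuousAt.tendsto.mono_left
      nhdsWithin_le_nhds
  have := le_of_tendsto_of_tendsto t1 t2 (by
    filter_upwards [self_mem_nhdsWithin, nhdsWithin_le_nhds (lt_mem_nhds one_pos)] with c h1 h2
    exact key c h2 h1)
  linarith

/-- Subsolutions in the degenerate case are equi-Lipschitz. -/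
theorem exists_lipBound_of_rowSum_zero (hD : IsCouplingMatrix D)
    (hirr : ∀ x, IsIrreducibleMatrix (D x)) (hF : IsEikonalFamily F f)
    (hrow : ∀ x i, ∑ j, D x i j = 0) :
    ∃ K, 0 ≤ K ∧ ∀ (v : Space N → Fin m → ℝ) (M : ℝ), Continuous v → (∀ x i, v x i ≤ M) →
      (∀ i, ViscSub (F i) (residual D f v i) fun x => v x i) →
        ∀ i, LipBound K fun x => v x i := by
  obtain ⟨Cf, hCf0, hCf⟩ := exists_abs_le_of_fin hF.periodic_f hF.continuous_f
  obtain ⟨CD, hCD0, hCD⟩ := hD.exists_abs_le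
  obtain ⟨B, hB0, hB⟩ := hD.exists_sub_le hirr hrow
  obtain ⟨K, hK0, hK⟩ := hF.exists_lipBound (Cf + ∑ _j : Fin m, CD * (B * Cf))
  refine ⟨K, hK0, fun v M hc hM hv i => ?_⟩
  have hci : ∀ i, Continuous fun x => v x i := fun i => (continuous_apply i).comp hc
  refine hK i _ _ (hv i) (hci i).upperSemicontinuous ⟨M, fun x => hM x i⟩ fun x => ?_
  -- `D v ≤ f` bounds the differences of components, and with zero row sums only these enter the
  -- residual. The bound therefore does not depend on `v` or `M`.
  have hosc := hB Cf hCf0 x (v x) fun i => by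
    have h1 := (hv i).nonneg (hci i) (hD.continuous_residual hF hc i) (hF.F_nonneg i) x
    have h2 := (le_abs_self _).trans (hCf i x)
    simp only [residual] at h1
    linarith
  have h1 : -∑ j, D x i j * v x j ≤ ∑ _j : Fin m, CD * (B * Cf) := by
    have : -∑ j, D x i j * v x j = ∑ j, -(D x i j * (v x j - v x i)) := by
      simp only [mul_sub, Finset.sum_neg_distrib, Finset.sum_sub_distrib, ← Finset.sum_mul, hrow]
      simp
    rw [this]
    refine Finset.sum_le_sum fun j _ => (neg_le_abs _).trans ?_
    rw [abs_mul]
    exact mul_le_mul (hCD i j x) (abs_sub_le_iff.2 ⟨hosc j i, hosc i j⟩) (abs_nonneg _) hCD0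
  have h2 := (le_abs_self _).trans (hCf i x)
  simp only [residual]
  linarith

end Degenerate

/-! ### The function `S` and extension of compatible data. -/

section MaximalSubsolution

variable {N m : ℕ} {F : Fin m → Space N → Space N → ℝ} {f : Fin m → Space N → ℝ}

/-- `max_i F_i ≤ min_j f_j` amounts to all the inequalities `F_i ≤ f_j`, so the scalar lemmas apply
to each continuous convex `F i`. -/
theorem isScalarSubsolution_iff (hm : 0 < m) {v : Space N → ℝ} :
    IsScalarSubsolution (maxF F) (minf f) v ↔
      IsPeriodic v ∧ UpperSemicontinuous v ∧ ∀ i j, ViscSub (F i) (f j) v := by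
  have : Nonempty (Fin m) := ⟨⟨0, hm⟩⟩
  have hle : ∀ x p, maxF F x p ≤ minf f x ↔ ∀ i j, F i x p ≤ f j x := by
    intro x p
    rw [maxF, ciSup_le_iff (finite_range _).bddAbove]
    simp only [minf, le_ciInf_iff (finite_range _).bddBelow]
  simp only [IsScalarSubsolution, hle, ViscSub]
  exact and_congr_right fun _ => and_congr_right fun _ =>
    ⟨fun h i j φ x a b => h φ x a b i j, fun h φ x a b i j => h i j φ x a b⟩

theorem isScalarSubsolution_const (hm : 0 < m) (hF : IsEikonalFamily F f) (c : ℝ) :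
    IsScalarSubsolution (maxF F) (minf f) fun _ => c :=
  (isScalarSubsolution_iff hm).2 ⟨fun _ _ => rfl, upperSemicontinuous_const, fun i j =>
    viscSub_const (fun x => by rw [hF.F_zero]; exact hF.f_nonneg j x) c⟩

theorem isScalarSubsolution_sub_const (hm : 0 < m) {v : Space N → ℝ}
    (h : IsScalarSubsolution (maxF F) (minf f) v) (c : ℝ) :
    IsScalarSubsolution (maxF F) (minf f) fun x => v x - c := by
  rw [isScalarSubsolution_iff hm] at h ⊢
  refine ⟨fun x k => by simp only [h.1 x k], ?_, fun i j => (h.2.2 i j).sub_const c⟩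
  simpa only [sub_eq_add_neg] using h.2.1.add upperSemicontinuous_const

theorem exists_lipBound_of_isScalarSubsolution (hm : 0 < m) (hF : IsEikonalFamily F f) :
    ∃ K, 0 ≤ K ∧ (∀ i j x p, F i x p ≤ f j x → ‖p‖ ≤ K) ∧
      ∀ v, IsScalarSubsolution (maxF F) (minf f) v → LipBound K v := by
  obtain ⟨C, -, hC⟩ := exists_abs_le_of_fin hF.periodic_f hF.continuous_f
  obtain ⟨K, hK0, hK⟩ := hF.exists_norm_le C
  have hK' : ∀ i j x p, F i x p ≤ f j x → ‖p‖ ≤ K := fun i j x p hp =>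
    hK i x p (hp.trans ((le_abs_self _).trans (hC j x)))
  refine ⟨K, hK0, hK', fun v hv => ?_⟩
  obtain ⟨hp, hu, hs⟩ := (isScalarSubsolution_iff hm).1 hv
  obtain ⟨x₀, h₀⟩ := hp.exists_isMax_of_upperSemicontinuous hu
  exact (hs ⟨0, hm⟩ ⟨0, hm⟩).lipBound hu ⟨_, h₀⟩ hK0 (hK' _ _)

theorem subsolutionValues_nonempty (hm : 0 < m) (hF : IsEikonalFamily F f) (y x : Space N) :
    (subsolutionValues (maxF F) (minf f) y x).Nonempty :=
  ⟨0, _, isScalarSubsolution_const hm hF 0, rfl, rfl⟩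

theorem subsolutionValues_bddAbove (hm : 0 < m) (hF : IsEikonalFamily F f) (y x : Space N) :
    BddAbove (subsolutionValues (maxF F) (minf f) y x) := by
  obtain ⟨K, -, -, hK⟩ := exists_lipBound_of_isScalarSubsolution hm hF
  refine ⟨K * ‖x - y‖, ?_⟩
  rintro _ ⟨v, hv, hvy, rfl⟩
  have := hK v hv x y
  linarith

theorem sub_le_maximalSubsolution (hm : 0 < m) (hF : IsEikonalFamily F f) {v : Space N → ℝ}
    (hv : IsScalarSubsolution (maxF F) (minf f) v) (y x : Space N) :
    v x - v y ≤ maximalSubsolution F f y x :=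
  le_csSup (subsolutionValues_bddAbove hm hF y x)
    ⟨_, isScalarSubsolution_sub_const hm hv (v y), sub_self _, rfl⟩

theorem exists_lt_of_lt_maximalSubsolution (hm : 0 < m) (hF : IsEikonalFamily F f)
    {y x : Space N} {r : ℝ} (hr : r < maximalSubsolution F f y x) :
    ∃ v, IsScalarSubsolution (maxF F) (minf f) v ∧ v y = 0 ∧ r < v x := by
  obtain ⟨_, ⟨v, hv, hvy, rfl⟩, h⟩ := exists_lt_of_lt_csSup (subsolutionValues_nonempty hm hF y x) hr
  exact ⟨v, hv, hvy, h⟩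

theorem maximalSubsolution_self (hm : 0 < m) (hF : IsEikonalFamily F f) (y : Space N) :
    maximalSubsolution F f y y = 0 := by
  have : subsolutionValues (maxF F) (minf f) y y = {0} := by
    ext r
    refine ⟨fun ⟨v, _, hvy, hr⟩ => hr.symm.trans hvy, fun hr => ?_⟩
    rw [mem_singleton_iff.1 hr]
    exact ⟨_, isScalarSubsolution_const hm hF 0, rfl, rfl⟩
  rw [maximalSubsolution, this, csSup_singleton]

/-- Stability under suprema of equi-Lipschitz families: the supremum itself competes, so it is a
maximum. -/
theorem isScalarSubsolution_maximalSubsolution (hm : 0 < m) (hF : IsEikonalFamily F f)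
    (y : Space N) : IsScalarSubsolution (maxF F) (minf f) (maximalSubsolution F f y) := by
  obtain ⟨K, hK0, -, hK⟩ := exists_lipBound_of_isScalarSubsolution hm hF
  set ι := {v // IsScalarSubsolution (maxF F) (minf f) v ∧ v y = 0}
  have hub : ∀ (v : ι) x, v.1 x ≤ maximalSubsolution F f y x := fun v x =>
    le_csSup (subsolutionValues_bddAbove hm hF y x) ⟨v.1, v.2.1, v.2.2, rfl⟩
  have hlub : ∀ x, ∀ ε > 0, ∃ v : ι, maximalSubsolution F f y x - ε < v.1 x := fun x ε hε => by
    obtain ⟨v, h1, h2, h3⟩ := exists_lt_of_lt_maximalSubsolution hm hF (sub_lt_self _ hε)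
    exact ⟨⟨v, h1, h2⟩, h3⟩
  have hL := LipBound.iSup (v := fun v : ι => v.1) (fun v => hK v.1 v.2.1) hub hlub
  refine (isScalarSubsolution_iff hm).2 ⟨fun x k => ?_, hL.continuous.upperSemicontinuous,
    fun i j => ?_⟩
  · have : subsolutionValues (maxF F) (minf f) y (x + latticeVec k)
        = subsolutionValues (maxF F) (minf f) y x := by
      ext r
      constructor <;> rintro ⟨v, hv, h1, h2⟩ <;> refine ⟨v, hv, h1, ?_⟩
      · rwa [hv.1 x k] at h2
      · rwa [hv.1 x k]
    simp only [maximalSubsolution, this]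
  · refine ViscSub.iSup (v := fun v : ι => v.1) (d := fun _ => 0) (hF.continuous_F i)
      (hF.continuous_f j) continuous_const hK0 (fun v => hK v.1 v.2.1) (fun v => ?_) hub hlub
    simpa using ((isScalarSubsolution_iff hm).1 v.2.1).2.2 i j

theorem isGreatest_maximalSubsolution (hm : 0 < m) (hF : IsEikonalFamily F f) (y x : Space N) :
    IsGreatest (subsolutionValues (maxF F) (minf f) y x) (maximalSubsolution F f y x) :=
  ⟨⟨_, isScalarSubsolution_maximalSubsolution hm hF y, maximalSubsolution_self hm hF y, rfl⟩,
    fun _ hr => le_csSup (subsolutionValues_bddAbove hm hF y x) hr⟩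

/-- The functions `x ↦ c - S(x, y)` are subsolutions as well. -/
theorem isScalarSubsolution_const_sub_maximalSubsolution (hm : 0 < m) (hF : IsEikonalFamily F f)
    (y : Space N) (c : ℝ) :
    IsScalarSubsolution (maxF F) (minf f) fun x => c - maximalSubsolution F f x y := by
  obtain ⟨K, hK0, hKp, hK⟩ := exists_lipBound_of_isScalarSubsolution hm hF
  set ι := {v // IsScalarSubsolution (maxF F) (minf f) v}
  have hub : ∀ (v : ι) x, v.1 y - v.1 x ≤ maximalSubsolution F f x y := fun v x =>
    sub_le_maximalSubsolution hm hF v.2 x y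
  have hlub : ∀ x, ∀ ε > 0, ∃ v : ι, maximalSubsolution F f x y - ε < v.1 y - v.1 x :=
    fun x ε hε => by
      obtain ⟨v, h1, h2, h3⟩ := exists_lt_of_lt_maximalSubsolution hm hF
        (sub_lt_self (maximalSubsolution F f x y) hε)
      exact ⟨⟨v, h1⟩, by simpa only [h2, sub_zero] using h3⟩
  have hLv : ∀ v : ι, LipBound K fun x => v.1 y - v.1 x := fun v =>
    (hK v.1 v.2).neg_add_const _
  have hL : LipBound K fun x => maximalSubsolution F f x y :=
    LipBound.iSup (v := fun v : ι => fun x => v.1 y - v.1 x) hLv hub hlub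
  refine (isScalarSubsolution_iff hm).2 ⟨fun x k => ?_,
    (hL.neg_add_const c).continuous.upperSemicontinuous, fun i j => ?_⟩
  · have : subsolutionValues (maxF F) (minf f) (x + latticeVec k) y
        = subsolutionValues (maxF F) (minf f) x y := by
      ext r
      constructor <;> rintro ⟨v, hv, h1, h2⟩ <;> refine ⟨v, hv, ?_, h2⟩
      · rwa [hv.1 x k] at h1
      · rwa [hv.1 x k]
    simp only [maximalSubsolution, this]
  · have hz : ∀ x, F i x 0 ≤ f j x := fun x => by rw [hF.F_zero]; exact hF.f_nonneg j x
    have hGc : Continuous fun z : Space N × Space N => F i z.1 (-z.2) :=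
      (hF.continuous_F i).comp (by fun_prop : Continuous fun z : Space N × Space N => (z.1, -z.2))
    -- `S(·, y)` is the supremum of `v y - v ·` over all subsolutions `v`. Each is a subsolution for
    -- the reflected Hamiltonian, hence so is the supremum, and a second reflection returns to `F
    -- i`.
    have h1 : ViscSub (fun x p => F i x (-p)) (f j) fun x => maximalSubsolution F f x y := by
      refine ViscSub.iSup (v := fun v : ι => fun x => v.1 y - v.1 x) (d := fun _ => 0) hGc
        (hF.continuous_f j) continuous_const hK0 hLv (fun v => ?_) hub hlub
      simpa using (((isScalarSubsolution_iff hm).1 v.2).2.2 i j).const_sub (hK v.1 v.2) hK0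
        (hF.continuous_F i) (hF.continuous_f j) (hF.convex i) (hKp i j) hz (v.1 y)
    have h2 := h1.const_sub hL hK0 hGc (hF.continuous_f j)
      (fun x => (hF.convex i x).comp_linearMap (-LinearMap.id : Space N →ₗ[ℝ] Space N))
      (fun x p hp => by simpa using hKp i j x (-p) hp) (fun x => by simpa using hz x) c
    simpa using h2

/-- Boundary data compatible with `S` extend to a subsolution. -/
theorem exists_isScalarSubsolution_extension (hm : 0 < m) (hF : IsEikonalFamily F f)
    {Z : Set (Space N)} (hZ : Z.Nonempty) {h : Space N → ℝ}
    (hh : ∀ x ∈ Z, ∀ y ∈ Z, h x - h y ≤ maximalSubsolution F f y x) :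
    ∃ w, IsScalarSubsolution (maxF F) (minf f) w ∧ ∀ x ∈ Z, w x = h x := by
  obtain ⟨K, hK0, -, hK⟩ := exists_lipBound_of_isScalarSubsolution hm hF
  have hsub := fun y => isScalarSubsolution_const_sub_maximalSubsolution hm hF y (h y)
  obtain ⟨z, hz⟩ := hZ
  have : Nonempty Z := ⟨⟨z, hz⟩⟩
  have hbdd : ∀ x, BddAbove (range fun y : Z => h y - maximalSubsolution F f x y) := by
    intro x
    refine ⟨h z + K * ‖x - z‖, ?_⟩
    rintro _ ⟨y, rfl⟩
    have h1 := hK _ (hsub y) x z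
    have h2 := hh y y.2 z hz
    simp only at h1 ⊢
    linarith
  -- A McShane-type extension. On `Z` the choice `y = x` gives `w ≥ h`, and compatibility gives `w ≤
  -- h`.
  set w : Space N → ℝ := fun x => ⨆ y : Z, (h y - maximalSubsolution F f x y) with hw
  have hub : ∀ (y : Z) x, h y - maximalSubsolution F f x y ≤ w x := fun y x =>
    le_ciSup (hbdd x) y
  have hlub : ∀ x, ∀ ε > 0, ∃ y : Z, w x - ε < h y - maximalSubsolution F f x y := fun x ε hε =>
    exists_lt_of_lt_ciSup (sub_lt_self _ hε)
  have hL : LipBound K w := LipBound.iSup (fun y : Z => hK _ (hsub y)) hub hlub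
  refine ⟨w, (isScalarSubsolution_iff hm).2 ⟨fun x k => ?_, hL.continuous.upperSemicontinuous,
    fun i j => ?_⟩, fun x hx => le_antisymm (ciSup_le fun y => ?_) ?_⟩
  · exact iSup_congr fun y => (hsub y).1 x k
  · refine ViscSub.iSup (d := fun _ => 0) (hF.continuous_F i) (hF.continuous_f j)
      continuous_const hK0 (fun y : Z => hK _ (hsub y)) (fun y => ?_) hub hlub
    simpa using ((isScalarSubsolution_iff hm).1 (hsub y)).2.2 i j
  · linarith [hh y y.2 x hx]
  · have := hub ⟨x, hx⟩ x
    simpa [maximalSubsolution_self hm hF] using this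

end MaximalSubsolution

/-! ### Zero row sums: existence. -/

section Degenerate

variable {N m : ℕ} {D : Space N → Matrix (Fin m) (Fin m) ℝ} {F : Fin m → Space N → Space N → ℝ}
  {f : Fin m → Space N → ℝ}

theorem IsEikonalFamily.isClosed_zeroSet (hF : IsEikonalFamily F f) : IsClosed (zeroSet f) :=
  isClosed_eq (continuous_finsetSum _ fun i _ => hF.continuous_f i) continuous_const

theorem IsEikonalFamily.add_latticeVec_mem_zeroSet (hF : IsEikonalFamily F f) {x : Space N}
    (hx : x ∈ zeroSet f) (k : Fin N → ℤ) : x + latticeVec k ∈ zeroSet f := by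
  have h : ∑ i, f i x = 0 := hx
  show ∑ i, f i (x + latticeVec k) = 0
  rw [← h]
  exact Finset.sum_congr rfl fun i _ => hF.periodic_f i x k

/-- Existence in the degenerate case: a scalar subsolution `w` prescribes the values of a solution
on the zero set. -/
theorem exists_solution_of_rowSum_zero (hm : 0 < m) (hD : IsCouplingMatrix D)
    (hirr : ∀ x, IsIrreducibleMatrix (D x)) (hF : IsEikonalFamily F f)
    (hrow : ∀ x i, ∑ j, D x i j = 0) (hne : (zeroSet f).Nonempty) {w : Space N → ℝ}
    (hw : IsScalarSubsolution (maxF F) (minf f) w) :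
    ∃ u : Space N → Fin m → ℝ, IsSolution (fun i x p => F i x p - f i x) D u ∧
      ∀ x ∈ zeroSet f, ∀ i, u x i = w x := by
  obtain ⟨K₀, -, -, hK₀⟩ := exists_lipBound_of_isScalarSubsolution hm hF
  have hwc := (hK₀ w hw).continuous
  obtain ⟨hwp, -, hws⟩ := (isScalarSubsolution_iff hm).1 hw
  obtain ⟨K, hK0, hK⟩ := exists_lipBound_of_rowSum_zero hD hirr hF hrow
  obtain ⟨C, hC0, hC⟩ := hwp.exists_abs_le hwc
  obtain ⟨z, hz⟩ := hne
  have hKN : 0 ≤ K * √N := by positivity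
  -- Every point lies within `√N` of a translate of `z`, where the envelope equals `w ≤ C`. By the
  -- Lipschitz bound the envelope stays strictly below `M`, so this barrier is never touched.
  set M := C + K * √N + 1 with hM
  set v₀ : Space N → Fin m → ℝ := fun x _ => w x with hv₀
  have hv₀p : IsPeriodic v₀ := fun x k => by simp only [hv₀, hwp x k]
  have hLip : ∀ v, PerronClass D F f (zeroSet f) v₀ M v → ∀ i, LipBound K fun x => v x i :=
    fun v hv => hK v M hv.continuous hv.upper hv.sub
  have hres : ∀ i x, residual D f v₀ i x = f i x := fun i x => by
    simp only [residual, hv₀, ← Finset.sum_mul, hrow, zero_mul, sub_zero]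
  have h₀ : PerronClass D F f (zeroSet f) v₀ M v₀ :=
    ⟨continuous_pi fun _ => hwc, fun i => (hws i i).mono fun x => (hres i x).ge,
      fun _ _ => le_rfl, fun x i => by
        have := (le_abs_self _).trans (hC x)
        simp only [hv₀]
        linarith, fun _ _ => rfl⟩
  have hu := perronSup_mem hD hF h₀ hK0 hLip
  refine ⟨_, isSolution_iff.2 ⟨hu.continuous, perronSup_isPeriodic hD hF
    (fun x hx k => hF.add_latticeVec_mem_zeroSet hx k) h₀ hv₀p, hu.sub, fun i φ x hφ hx => ?_⟩,
    fun x hx i => by rw [hu.eqOn x hx]⟩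
  -- On the zero set the components all equal `w`, so the residual is `f i x = 0` and the test
  -- reduces to `F ≥ 0`.
  by_cases hxZ : x ∈ zeroSet f
  · have h1 := hF.F_nonneg i x (gradient φ x)
    have h2 : residual D f (perronSup D F f (zeroSet f) v₀ M) i x = residual D f v₀ i x := by
      simp only [residual, hu.eqOn x hxZ]
    rw [h2, hres, hF.eq_zero_of_mem hxZ]
    exact h1
  · refine perronSup_super hD hF hF.isClosed_zeroSet hu hφ hx hxZ ?_
    obtain ⟨k, hk⟩ := exists_norm_sub_add_latticeVec_le x z
    have h1 := hLip _ hu i x (z + latticeVec k)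
    simp only [hu.eqOn _ (hF.add_latticeVec_mem_zeroSet hz k)] at h1
    have h2 := (le_abs_self _).trans (hC (z + latticeVec k))
    have h3 := mul_le_mul_of_nonneg_left hk hK0
    simp only [hv₀] at h1
    linarith

end Degenerate

end WeaklyCoupledHJ

end
-- The main theorem.
open WeaklyCoupledHJ in
theorem proposition3p4 {N m : ℕ} (hm : 0 < m)
    (D : Space N → Matrix (Fin m) (Fin m) ℝ)
    (F : Fin m → Space N → Space N → ℝ) (f : Fin m → Space N → ℝ)
    (hD : IsCouplingMatrix D) (hirr : ∀ x, IsIrreducibleMatrix (D x))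
    (hF : IsEikonalFamily F f) :
    -- (i) classical case
    ((∀ x i, 0 < ∑ j, D x i j) →
      ∃! u : Space N → Fin m → ℝ, IsSolution (fun i x p => F i x p - f i x) D u) ∧
    -- (ii) degenerate case
    ((∀ x i, ∑ j, D x i j = 0) → (zeroSet f).Nonempty →
      -- the maximum defining `S` is attained, and a vector field `Λ` exists
      (∀ y x, IsGreatest (subsolutionValues (maxF F) (minf f) y x)
        (maximalSubsolution F f y x)) ∧
      (∃ Λ : Space N → Fin m → ℝ, IsPositiveCokernel D Λ) ∧
      ∀ Λ : Space N → Fin m → ℝ, IsPositiveCokernel D Λ →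
        ∀ g : Space N → ℝ, ContinuousOn g (zeroSet f) →
          (∀ x ∈ zeroSet f, ∀ k : Fin N → ℤ, g (x + latticeVec k) = g x) →
          (∀ x ∈ zeroSet f, ∀ y ∈ zeroSet f,
            g x * (∑ i, Λ x i)⁻¹ - g y * (∑ i, Λ y i)⁻¹ ≤ maximalSubsolution F f y x) →
          ∃! u : Space N → Fin m → ℝ,
            IsSolution (fun i x p => F i x p - f i x) D u ∧
              ∀ x ∈ zeroSet f, ∑ i, Λ x i * u x i = g x) := by
  constructor
  · intro hpos
    obtain ⟨u, hu⟩ := exists_solution_of_rowSum_pos hD hF hpos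
    refine ⟨u, hu, fun v hv => ?_⟩
    ext x i
    exact le_antisymm (solution_le_of_rowSum_pos hm hD hF hpos hv hu x i)
      (solution_le_of_rowSum_pos hm hD hF hpos hu hv x i)
  · intro hrow hne
    refine ⟨isGreatest_maximalSubsolution hm hF, hD.exists_isPositiveCokernel hm hirr hrow,
      fun Λ hΛ g _ _ hg => ?_⟩
    have hΛpos : ∀ x, 0 < ∑ i, Λ x i := fun x =>
      Finset.sum_pos (fun i _ => hΛ.2.2.1 x i) ⟨⟨0, hm⟩, Finset.mem_univ _⟩
    -- Equality of the components on the zero set turns the weighted condition into prescribed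
    -- values for each component.
    have hval : ∀ u : Space N → Fin m → ℝ, IsSolution (fun i x p => F i x p - f i x) D u →
        (∀ x ∈ zeroSet f, ∑ i, Λ x i * u x i = g x) →
          ∀ x ∈ zeroSet f, ∀ i, u x i = g x * (∑ i, Λ x i)⁻¹ := by
      intro u hu hgu x hx i
      obtain ⟨hc, -, hs, -⟩ := isSolution_iff.1 hu
      rw [eq_mul_inv_iff_mul_eq₀ (hΛpos x).ne', ← hgu x hx, Finset.mul_sum]
      refine Finset.sum_congr rfl fun j _ => ?_
      rw [eq_of_mem_zeroSet hD hirr hF hrow hc hs hx j i, mul_comm]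
    obtain ⟨w, hw, hwg⟩ := exists_isScalarSubsolution_extension hm hF hne
      (h := fun x => g x * (∑ i, Λ x i)⁻¹) hg
    obtain ⟨u, hu, huw⟩ := exists_solution_of_rowSum_zero hm hD hirr hF hrow hne hw
    have hug : ∀ x ∈ zeroSet f, ∑ i, Λ x i * u x i = g x := by
      intro x hx
      simp only [huw x hx, hwg x hx, ← Finset.sum_mul]
      rw [mul_comm, inv_mul_cancel_right₀ (hΛpos x).ne']
    refine ⟨u, ⟨hu, hug⟩, fun v ⟨hv, hvg⟩ => ?_⟩
    have heq : ∀ x ∈ zeroSet f, ∀ i, v x i = u x i := fun x hx i =>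
      (hval v hv hvg x hx i).trans (hval u hu hug x hx i).symm
    ext x i
    exact le_antisymm
      (solution_le_of_rowSum_zero hm hD hirr hF hrow hv hu (fun x hx i => (heq x hx i).le) x i)
      (solution_le_of_rowSum_zero hm hD hirr hF hrow hu hv (fun x hx i => (heq x hx i).ge) x i)
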